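/- Let $A=\begin{pmatrix}a&b\\c&d\end{pmatrix}\in SL(2,\mathbb Z)$ with $a+d>2$, let $L_A$ be the induced automorphism of $\mathbb T^2=\mathbb R^2/\mathbb Z^2$, and let $\Lambda=\log\frac{(a+d)+\sqrt{(a+d)^2-4}}{2}$ be the logarithm of the larger eigenvalue of $A$ (this is the topological entropy of $L_A$). Use the coordinates $(s_1,s_2)\mapsto s_1v^u+s_2v^s$ near $0\in\mathbb T^2$, where $v^{u}=(2b,\,d-a+\sqrt{(a+d)^2-4})$ and $v^{s}=(2b,\,d-a-\sqrt{(a+d)^2-4})$ are eigenvectors of $A$ for $e^{\Lambda}$ and $e^{-\Lambda}$, and put $D_r=\{s_1^2+s_2^2\le r^2\}$. Fix $\alpha\in(0,\frac13)$ and $\varepsilon\in(0,1)$ with $\frac{1+\alpha}{(1-\varepsilon)^{2(1+\alpha)}}<\frac43$. For $r_0\in(0,1)$, an admissible family is a family of functions $\psi_\eta:[0,1]\to[0,1]$, $0\le\eta\le 2r_0^2$, such that 1. $\psi_0(u)=(u/r_0^2)^{1+\alpha}$ for $0\le u\le (r_0/2)^2$, and on $[(r_0/2)^2,r_0^2]$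 one has $\psi_0(u)\ge (u/r_0^2)^{1+\alpha}$; 2. for every $\eta$: $\psi_\eta(u)>0$ and $\psi_\eta'(u)\ge0$ for $0<u<r_0^2$, $\psi_\eta(u)=1$ for $u\ge r_0^2$, $\psi_\eta(u)=\psi_0(\eta/2)$ for $0\le u\le\eta/4$, $\psi_\eta(u)=\psi_0(u)$ for $u\ge\eta$, and $\psi_\eta'(u)\le\frac{1+\alpha}{(1-\varepsilon)^{2(1+\alpha)}r_0^2}\left(\frac{u}{r_0^2}\right)^{\alpha}$ for $u\in(0,1)$; 3. $\psi_{\eta_1}\le\psi_{\eta_2}$ if $\eta_1\le\eta_2$, $\psi_\eta\to\psi_0$ pointwise as $\eta\to0^+$, and $(\eta,u)\mapsto\psi_\eta(u)$ is $C^\infty$ on $([0,2r_0^2]\times[0,1])\setminus\{(0,0)\}$. Extend $\psi_\eta$ by $1$ to $[1,\infty)$, let $g_\eta$ be the time-one map of the flow $$\dot s_1=s_1\,\psi_\eta(s_1^2+s_2^2)\,\Lambda,\qquad \dot s_2=-s_2\,\psi_\eta(s_1^2+s_2^2)\,\Lambda,$$ put $r_1=2e^{\Lambda}r_0$, and, for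 small $r_0$, let $G_{0,\eta}:\mathbb T^2\to\mathbb T^2$ be equal to $g_\eta$ on $D_{r_1}$ and to $L_A$ on $\mathbb T^2\setminus D_{r_1}$. Then for every $\chi>0$ there is $r_\chi\in(0,1)$, depending only on $A,\alpha,\varepsilon,\chi$, such that for every $r_0\in(0,r_\chi)$, every admissible family $(\psi_\eta)$ for $r_0$, every $\eta\in(0,2r_0^2]$, every $x\in\mathbb T^2$ and every nonzero $v\in T_x\mathbb T^2$, $$\lambda(G_{0,\eta},x,v)=\limsup_{n\to\infty}\frac1n\log\|D_xG_{0,\eta}^n v\|<\Lambda+\chi .$$ In particular, $\lambda_{mme}(G_{0,\eta})<\Lambda+\chi$ for all such $r_0$, $(\psi_\eta)$ and $\eta$, where $\lambda_{mme}$ denotes the positive Lyapunov exponent with respect to the measure of maximal entropy. -/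

import Mathlib

open Set Filter Topology MeasureTheory
open scoped ContDiff

noncomputable section

namespace SlowDown

/-! ### The two-torus and differentiation on it -/

/-- The torus `𝕋² = ℝ² / ℤ²`. -/
abbrev Torus := UnitAddTorus (Fin 2)

/-- `ℝ²` with the Euclidean norm; it is also every tangent space of `𝕋²`. -/
abbrev Plane := EuclideanSpace ℝ (Fin 2)

/-- The quotient map `ℝ² → 𝕋²`. -/
def proj (w : Plane) : Torus := fun i => (w i : UnitAddCircle)

/-- The representative in `[-1/2, 1/2)²` of a point of `𝕋²`. Near `0` it is the inverse of
the local diffeomorphism `proj`. -/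
def rep (q : Torus) : Plane :=
  WithLp.toLp 2 (fun i => ((AddCircle.equivIco (1 : ℝ) (-1 / 2) (q i) : ℝ)))

/-- The differential `D_p f : T_p 𝕋² → T_{f p} 𝕋²`, computed in the translation charts
`w ↦ p + proj w` at `p` and `w ↦ f p + proj w` at `f p`. -/
def torusDeriv (f : Torus → Torus) (p : Torus) : Plane →L[ℝ] Plane :=
  fderiv ℝ (fun w : Plane => rep (f (p + proj w) - f p)) 0

/-- The forward Lyapunov exponent
`λ(f, p, v) = limsup_{n → ∞} (1/n) log ‖D_p fⁿ v‖`, as an extended real number. -/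
def lyapunovExponent (f : Torus → Torus) (p : Torus) (v : Plane) : EReal :=
  limsup (fun n : ℕ => ((Real.log ‖torusDeriv (f^[n]) p v‖ / n : ℝ) : EReal)) atTop

/-! ### Metric entropy, the measure of maximal entropy and its Lyapunov exponent -/

/-- The Shannon entropy of `ξ ∨ f⁻¹ ξ ∨ ⋯ ∨ f^{-(n-1)} ξ`, where `ξ : X → Fin k` stands for the
partition of `X` into its level sets. -/
def partitionEntropy {X : Type*} [MeasurableSpace X] (f : X → X) (μ : Measure X) {k : ℕ}
    (ξ : X → Fin k) (n : ℕ) : ℝ :=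
  ∑ w : Fin n → Fin k, Real.negMulLog (μ.real {x | ∀ i : Fin n, ξ (f^[i] x) = w i})

/-- The (Kolmogorov-Sinai) metric entropy `h_μ(f)`: the supremum over all finite measurable
partitions `ξ` of `lim_n (1/n) H_μ(ξ ∨ ⋯ ∨ f^{-(n-1)} ξ)`. -/
def metricEntropy {X : Type*} [MeasurableSpace X] (f : X → X) (μ : Measure X) : EReal :=
  ⨆ (k : ℕ) (ξ : X → Fin k) (_ : Measurable ξ),
    limsup (fun n : ℕ => ((partitionEntropy f μ ξ n / n : ℝ) : EReal)) atTop

/-- `ν` is a measure of maximal entropy of `f`: an `f`-invariant probability measure whose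
metric entropy is the largest among all `f`-invariant probability measures. -/
structure IsMeasureOfMaximalEntropy {X : Type*} [MeasurableSpace X] (f : X → X)
    (ν : Measure X) : Prop where
  prob : IsProbabilityMeasure ν
  invariant : MeasurePreserving f ν ν
  maximal : ∀ μ : Measure X, IsProbabilityMeasure μ → MeasurePreserving f μ μ →
    metricEntropy f μ ≤ metricEntropy f ν

/-- `l` is a Lyapunov exponent of `f` with respect to `μ`: at `μ`-almost every point `p` it is the
limit of `(1/n) log ‖D_p fⁿ v‖` for some non-zero tangent vector `v`. -/
def IsLyapunovExponentOf (f : Torus → Torus) (μ : Measure Torus) (l : ℝ) : Prop :=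
  ∀ᵐ p ∂μ, ∃ v : Plane, v ≠ 0 ∧
    Tendsto (fun n : ℕ => Real.log ‖torusDeriv (f^[n]) p v‖ / n) atTop (𝓝 l)

/-- `l = λ_mme(f)`: `l` is the positive Lyapunov exponent of `f` with respect to the measure of
maximal entropy of `f`. -/
def IsLambdaMME (f : Torus → Torus) (l : ℝ) : Prop :=
  ∃ ν : Measure Torus, IsMeasureOfMaximalEntropy f ν ∧ 0 < l ∧ IsLyapunovExponentOf f ν l

/-! ### The linear automorphism and its eigencoordinates -/

/-- The automorphism `L_A` of `𝕋²` induced by `A ∈ SL(2, ℤ)`. -/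
def toralAut (A : Matrix.SpecialLinearGroup (Fin 2) ℤ) (p : Torus) : Torus :=
  fun i => ∑ j, A i j • p j

/-- `a + d`, as a real number. -/
def tr (A : Matrix.SpecialLinearGroup (Fin 2) ℤ) : ℝ := (A 0 0 : ℝ) + (A 1 1 : ℝ)

/-- `Λ = log μ⁺`, where `μ⁺ = (a + d + √((a + d)² - 4)) / 2` is the eigenvalue of `A` of largest
modulus. This number is the topological entropy of `L_A`. -/
def bigLambda (A : Matrix.SpecialLinearGroup (Fin 2) ℤ) : ℝ :=
  Real.log ((tr A + √(tr A ^ 2 - 4)) / 2)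

/-- The eigenvector `v^u = (2b, d - a + √((a + d)² - 4))` of `A` for the eigenvalue `e^Λ`. -/
def vu (A : Matrix.SpecialLinearGroup (Fin 2) ℤ) : Plane :=
  !₂[2 * (A 0 1 : ℝ), 2 * (A 1 1 : ℝ) - tr A + √(tr A ^ 2 - 4)]

/-- The eigenvector `v^s = (2b, d - a - √((a + d)² - 4))` of `A` for the eigenvalue `e^{-Λ}`. -/
def vs (A : Matrix.SpecialLinearGroup (Fin 2) ℤ) : Plane :=
  !₂[2 * (A 0 1 : ℝ), 2 * (A 1 1 : ℝ) - tr A - √(tr A ^ 2 - 4)]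

/-- The point of `𝕋²` with eigencoordinates `(s₁, s₂)` centred at the fixed point `0`. -/
def eigenPoint (A : Matrix.SpecialLinearGroup (Fin 2) ℤ) (s : ℝ × ℝ) : Torus :=
  proj (s.1 • vu A + s.2 • vs A)

/-- The disk `D_r = {s₁² + s₂² ≤ r²}` in eigencoordinates. -/
def disk (r : ℝ) : Set (ℝ × ℝ) := {s | s.1 ^ 2 + s.2 ^ 2 ≤ r ^ 2}

/-! ### The slow-down deformation -/

/-- `ψ η u = ψ_η(u)`, for `0 ≤ η ≤ 2r₀²`, is an admissible family of slow-down functions with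
parameters `α`, `ε` and slow-down radius `r₀`. The functions `ψ_η : [0, 1] → [0, 1]` are extended
by the value `1` to the right of `1`; their values at negative arguments are irrelevant. -/
structure IsSlowDownFamily (α ε r₀ : ℝ) (ψ : ℝ → ℝ → ℝ) : Prop where
  mem_Icc : ∀ η ∈ Icc 0 (2 * r₀ ^ 2), ∀ u ∈ Icc (0 : ℝ) 1, ψ η u ∈ Icc (0 : ℝ) 1
  /-- `ψ₀` is a power function near `0` -/
  zero_eq_rpow : ∀ u ∈ Icc 0 ((r₀ / 2) ^ 2), ψ 0 u = (u / r₀ ^ 2) ^ (1 + α)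
  zero_ge : ∀ u ∈ Icc ((r₀ / 2) ^ 2) (r₀ ^ 2), (u / r₀ ^ 2) ^ (1 + α) ≤ ψ 0 u
  zero_deriv_le : ∀ u ∈ Icc ((r₀ / 2) ^ 2) (r₀ ^ 2),
    deriv (ψ 0) u ≤ (1 + α) / ((1 - ε) ^ (2 * (1 + α)) * r₀ ^ 2) * (u / r₀ ^ 2) ^ α
  pos : ∀ η ∈ Icc 0 (2 * r₀ ^ 2), ∀ u ∈ Ioo 0 (r₀ ^ 2), 0 < ψ η u
  deriv_nonneg : ∀ η ∈ Icc 0 (2 * r₀ ^ 2), ∀ u ∈ Ioo 0 (r₀ ^ 2), 0 ≤ deriv (ψ η) u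
  eq_one : ∀ η ∈ Icc 0 (2 * r₀ ^ 2), ∀ u, r₀ ^ 2 ≤ u → ψ η u = 1
  eq_const : ∀ η ∈ Icc 0 (2 * r₀ ^ 2), ∀ u ∈ Icc 0 (η / 4), ψ η u = ψ 0 (η / 2)
  eq_zero : ∀ η ∈ Icc 0 (2 * r₀ ^ 2), ∀ u, η ≤ u → ψ η u = ψ 0 u
  mono : ∀ η₁ ∈ Icc 0 (2 * r₀ ^ 2), ∀ η₂ ∈ Icc 0 (2 * r₀ ^ 2), η₁ ≤ η₂ →
    ∀ u ∈ Icc (0 : ℝ) 1, ψ η₁ u ≤ ψ η₂ u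
  deriv_le : ∀ η ∈ Icc 0 (2 * r₀ ^ 2), ∀ u ∈ Ioo (0 : ℝ) 1,
    deriv (ψ η) u ≤ (1 + α) / ((1 - ε) ^ (2 * (1 + α)) * r₀ ^ 2) * (u / r₀ ^ 2) ^ α
  tendsto : ∀ u ∈ Icc (0 : ℝ) 1, Tendsto (fun η => ψ η u) (𝓝[>] 0) (𝓝 (ψ 0 u))
  /-- joint smoothness, away from the corner `(0, 0)`, where `u ^ (1 + α)` is not smooth -/
  smooth : ContDiffOn ℝ ∞ (Function.uncurry ψ)
    ((Icc 0 (2 * r₀ ^ 2) ×ˢ Icc 0 1) \ {(0, 0)})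

/-- The vector field `(s₁ ψ(s₁² + s₂²) Λ, -s₂ ψ(s₁² + s₂²) Λ)`. -/
def slowField (L : ℝ) (ψ : ℝ → ℝ) (s : ℝ × ℝ) : ℝ × ℝ :=
  (s.1 * ψ (s.1 ^ 2 + s.2 ^ 2) * L, -(s.2 * ψ (s.1 ^ 2 + s.2 ^ 2) * L))

open Classical in
/-- The time-one map of the flow of `slowField L ψ`: the value at time `1` of the solution
starting at `s` (which exists and is unique for the functions `ψ` considered here). -/
def timeOne (L : ℝ) (ψ : ℝ → ℝ) (s : ℝ × ℝ) : ℝ × ℝ :=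
  if h : ∃ γ : ℝ → ℝ × ℝ, γ 0 = s ∧ IsIntegralCurveOn γ (fun _ => slowField L ψ) (Icc 0 1)
  then h.choose 1 else s

open Classical in
/-- The slowed-down map of `L_A` for the slow-down function `ψ`: the time-one map of the slowed-down
flow in the disk `D_{r₁}`, where `r₁ = 2 e^Λ r₀`, and `L_A` outside of it. (For this `r₁` one has
`D_{r₀} ⊆ Int A(D_{r₁}) ∩ Int A⁻¹(D_{r₁})`, and `D_{r₁}` embeds in the torus for small `r₀`.) -/
def slowedMap (A : Matrix.SpecialLinearGroup (Fin 2) ℤ) (r₀ : ℝ) (ψ : ℝ → ℝ) (p : Torus) :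
    Torus :=
  if h : ∃ s ∈ disk (2 * Real.exp (bigLambda A) * r₀), eigenPoint A s = p
  then eigenPoint A (timeOne (bigLambda A) ψ h.choose)
  else toralAut A p

end SlowDown

end

/-!
# Lyapunov exponents of the slowed-down toral automorphism

In eigencoordinates the differential of the slowed-down field has an antisymmetric off-diagonal
part. Hence the length of a tangent vector grows at a rate of at most `Λ (ψ + 2 s₁² ψ')`
(`exists_inner_slowField_le`). This can exceed `Λ`, but where it does, `ψ` is bounded below by a
positive constant, because of the power law for `ψ₀ ≤ ψ`. So the excess is at most a constant times
`Λ ψ x / (1 + x)²` with `x = s₁² / r₀²` (`IsSlowProfile.rate_le`). As `s₁' = Λ ψ s₁`, that is a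
multiple of the time derivative of the bounded function `x / (1 + x)`, so a complete passage through
the slow-down disk costs at most a constant factor, no matter how long it lasts and how small `r₀`
and `η` are.

It remains to see that passages are rare. Instead of counting them, a bounded nonnegative potential
`Φ` on the torus is used (`torusPotential`), for which one step of the map expands by at most `e^{Λ
+ χ/2}` times the exponential of half the coboundary of `Φ` (`expandsAtMost_slowedMap`, which is
about squared distances). The potential gains the constant during a passage and gives it back at a
small rate per unit of `log (1 + x)`, that is, per unit of time, while the orbit travels along the
unstable direction from `D_{r₀}` to the boundary of a disk of fixed radius `R`. For small `r₀` this
way is long enough for `Φ` to vanish before the orbit leaves the disk (`IsSlowProfile.le_of_exit`),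
so that `Φ` can be extended by `0`. The coboundary telescopes, and since `Φ` is bounded, the
exponents are at most `Λ + χ/2`.

The expansion is measured by comparing nearby orbits (`ExpandsAtMost`), with a Grönwall estimate for
two integral curves (`exists_nsq_sub_le`). This gives the bound on the differential of each iterate
without a smooth dependence theorem for the flow and without the chain rule.
-/

noncomputable section

namespace SlowDown

/-! ### Slow-down profiles -/

/-- A single slow-down function `ψ_η` with `η > 0`, extended by a constant to negative arguments,
reduced to the properties that control the flow: it is differentiable, takes values in `(0, 1]`, is
nondecreasing with slope at most `4 / (3r²)`, equals `1` from `r²` on, and is at least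
`(u / r²)²` before. -/
structure IsSlowProfile (r : ℝ) (f : ℝ → ℝ) : Prop where
  differentiable : Differentiable ℝ f
  pos : ∀ u, 0 < f u
  le_one : ∀ u, f u ≤ 1
  deriv_nonneg : ∀ u, 0 ≤ deriv f u
  deriv_le : ∀ u, deriv f u ≤ 4 / 3 / r ^ 2
  eq_one : ∀ u, r ^ 2 ≤ u → f u = 1
  sq_le : ∀ u ∈ Icc 0 (r ^ 2), (u / r ^ 2) ^ 2 ≤ f u

lemma IsSlowDownFamily.isSlowProfile {α ε r₀ : ℝ} {ψ : ℝ → ℝ → ℝ}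
    (hψ : IsSlowDownFamily α ε r₀ ψ) (hα : α ∈ Ioo (0 : ℝ) (1 / 3)) (hr : r₀ ∈ Ioo (0 : ℝ) 1)
    (hαε : (1 + α) / (1 - ε) ^ (2 * (1 + α)) < 4 / 3) {η : ℝ} (hη : η ∈ Ioc 0 (2 * r₀ ^ 2)) :
    IsSlowProfile r₀ (fun u => ψ η (max u 0)) := by
  obtain ⟨hr0, hr1⟩ := hr
  have hr2 : 0 < r₀ ^ 2 := by positivity
  have hr3 : r₀ ^ 2 < 1 := by nlinarith
  have hη' : η ∈ Icc 0 (2 * r₀ ^ 2) := ⟨hη.1.le, hη.2⟩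
  have h0' : (0 : ℝ) ∈ Icc 0 (2 * r₀ ^ 2) := ⟨le_rfl, by positivity⟩
  set f : ℝ → ℝ := fun u => ψ η (max u 0) with hf
  have hloc : ∀ u, 0 < u → f =ᶠ[𝓝 u] ψ η := fun u hu => by
    filter_upwards [lt_mem_nhds hu] with y hy
    simp [hf, max_eq_left hy.le]
  have hconst : ∀ u, u < η / 4 → f =ᶠ[𝓝 u] fun _ => ψ 0 (η / 2) := fun u hu => by
    filter_upwards [gt_mem_nhds hu] with y hy
    exact hψ.eq_const η hη' _ ⟨le_max_right _ _, max_le hy.le (by linarith [hη.1])⟩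
  have hcont : ContDiffOn ℝ ∞ (ψ η) (Icc 0 1) := by
    have : ContDiffOn ℝ ∞ (Function.uncurry ψ ∘ fun u : ℝ => (η, u)) (Icc 0 1) := by
      refine hψ.smooth.comp (contDiff_const.prodMk contDiff_id).contDiffOn fun u hu => ?_
      exact ⟨⟨hη', hu⟩, fun h => hη.1.ne' (congrArg Prod.fst h)⟩
    exact this
  have hdiff : Differentiable ℝ f := fun u => by
    rcases lt_or_ge u (η / 4) with h | h
    · exact (differentiableAt_const _).congr_of_eventuallyEq (hconst u h)
    have hu : 0 < u := by linarith [hη.1]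
    rcases lt_or_ge u 1 with h1 | h1
    · exact ((hcont.differentiableOn (by simp)).differentiableAt
        (Icc_mem_nhds hu h1)).congr_of_eventuallyEq (hloc u hu)
    · refine (differentiableAt_const (1 : ℝ)).congr_of_eventuallyEq ?_
      filter_upwards [lt_mem_nhds (hr3.trans_le h1)] with y hy
      exact hψ.eq_one η hη' _ (hy.le.trans (le_max_left _ _))
  have hle : ∀ u, f u ≤ 1 := fun u => by
    rcases le_or_gt u 1 with h | h
    · exact (hψ.mem_Icc η hη' _ ⟨le_max_right _ _, max_le h zero_le_one⟩).2
    · exact (hψ.eq_one η hη' _ ((hr3.trans h).le.trans (le_max_left _ _))).le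
  have hone : ∀ u, r₀ ^ 2 ≤ u → f u = 1 := fun u hu =>
    hψ.eq_one η hη' _ (hu.trans (le_max_left _ _))
  -- to the right of `r₀²` the function attains its maximum, so its slope vanishes
  have hd1 : ∀ u, r₀ ^ 2 ≤ u → deriv f u = 0 := fun u hu =>
    IsLocalMax.deriv_eq_zero (Eventually.of_forall fun y => (hone u hu).symm ▸ hle y)
  have hd0 : ∀ u, u ≤ 0 → deriv f u = 0 := fun u hu => by
    rw [(hconst u (by linarith [hη.1])).deriv_eq, deriv_const]
  refine ⟨hdiff, fun u => ?_, hle, fun u => ?_, fun u => ?_, hone, fun u hu => ?_⟩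
  · rcases le_or_gt (r₀ ^ 2) u with h | h
    · rw [hone u h]; exact one_pos
    rcases le_or_gt u 0 with h0 | h0
    · rw [(hconst u (by linarith [hη.1])).eq_of_nhds]
      rcases le_or_gt (r₀ ^ 2) (η / 2) with h | h
      · rw [hψ.eq_one 0 h0' _ h]; exact one_pos
      · exact hψ.pos 0 h0' _ ⟨by linarith [hη.1], h⟩
    · rw [(hloc u h0).eq_of_nhds]
      exact hψ.pos η hη' u ⟨h0, h⟩
  · rcases le_or_gt (r₀ ^ 2) u with h | h
    · rw [hd1 u h]
    rcases le_or_gt u 0 with h0 | h0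
    · rw [hd0 u h0]
    · rw [(hloc u h0).deriv_eq]
      exact hψ.deriv_nonneg η hη' u ⟨h0, h⟩
  · rcases le_or_gt (r₀ ^ 2) u with h | h
    · rw [hd1 u h]; positivity
    rcases le_or_gt u 0 with h0 | h0
    · rw [hd0 u h0]; positivity
    · rw [(hloc u h0).deriv_eq]
      refine (hψ.deriv_le η hη' u ⟨h0, h.trans hr3⟩).trans ?_
      have h1 : (u / r₀ ^ 2) ^ α ≤ 1 :=
        Real.rpow_le_one (by positivity) ((div_le_one hr2).2 h.le) hα.1.le
      have h2 : (0 : ℝ) ≤ (u / r₀ ^ 2) ^ α := by positivity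
      rw [← div_div]
      calc _ ≤ 4 / 3 / r₀ ^ 2 * (u / r₀ ^ 2) ^ α := by gcongr
        _ ≤ 4 / 3 / r₀ ^ 2 * 1 := by gcongr
        _ = _ := mul_one _
  · have h1 : u / r₀ ^ 2 ≤ 1 := (div_le_one hr2).2 hu.2
    have h2 : 0 ≤ u / r₀ ^ 2 := div_nonneg hu.1 hr2.le
    have h3 : (u / r₀ ^ 2) ^ 2 ≤ (u / r₀ ^ 2) ^ (1 + α) := by
      rw [← Real.rpow_natCast]
      exact Real.rpow_le_rpow_of_exponent_ge' h2 h1 (by linarith [hα.1])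
        (by push_cast; linarith [hα.2])
    have h4 : (u / r₀ ^ 2) ^ (1 + α) ≤ ψ 0 u := by
      rcases le_or_gt u ((r₀ / 2) ^ 2) with h | h
      · exact (hψ.zero_eq_rpow u ⟨hu.1, h⟩).ge
      · exact hψ.zero_ge u ⟨h.le, hu.2⟩
    have h5 := hψ.mono 0 h0' η hη' hη.1.le u ⟨hu.1, hu.2.trans hr3.le⟩
    simp only [hf, max_eq_left hu.1]
    linarith

/-- The rate at which the linearised flow can expand, `ψ + 2 s₁² ψ'`, exceeds `1` by at most a
multiple of `ψ x / (1 + x)²`, where `x = s₁² / r²`. The latter is, up to a constant, the time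
derivative of the bounded quantity `x / (1 + x)` along the flow. -/
lemma IsSlowProfile.rate_le {r : ℝ} (hr : 0 < r) {f : ℝ → ℝ} (hf : IsSlowProfile r f) (z : ℝ × ℝ) :
    f (z.1 ^ 2 + z.2 ^ 2) + 2 * z.1 ^ 2 * deriv f (z.1 ^ 2 + z.2 ^ 2) ≤
      1 + 400 * (f (z.1 ^ 2 + z.2 ^ 2) * (z.1 ^ 2 / r ^ 2 / (1 + z.1 ^ 2 / r ^ 2) ^ 2)) := by
  have hr2 : 0 < r ^ 2 := by positivity
  set u := z.1 ^ 2 + z.2 ^ 2 with hu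
  set x := z.1 ^ 2 / r ^ 2 with hx
  have hx0 : 0 ≤ x := by positivity
  have hp := hf.pos u
  have h1 := hf.le_one u
  rcases le_or_gt (r ^ 2) u with h | h
  · have hd : deriv f u = 0 :=
      IsLocalMax.deriv_eq_zero (Eventually.of_forall fun y => (hf.eq_one u h).symm ▸ hf.le_one y)
    rw [hd]
    have : 0 ≤ f u * (x / (1 + x) ^ 2) := by positivity
    linarith
  have hd : 2 * z.1 ^ 2 * deriv f u ≤ 8 / 3 * x := by
    calc _ ≤ 2 * z.1 ^ 2 * (4 / 3 / r ^ 2) := by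
          gcongr
          exact hf.deriv_le u
      _ = _ := by rw [hx]; ring
  have hxw : x ≤ u / r ^ 2 := by
    rw [hx]; gcongr; rw [hu]; nlinarith [sq_nonneg z.2]
  have hw1 : u / r ^ 2 < 1 := (div_lt_one hr2).2 h
  have hx1 : x / 4 ≤ x / (1 + x) ^ 2 := by
    apply div_le_div_of_nonneg_left hx0 (by positivity)
    nlinarith
  have key : f u + 8 / 3 * x ≤ 1 + 100 * (f u * x) := by
    rcases le_or_gt (f u) (1 / 2) with hh | hh
    · rcases le_or_gt (3 / 16) (u / r ^ 2) with hw | hw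
      · have := hf.sq_le u ⟨by positivity, h.le⟩
        have h3 : (9 / 256 : ℝ) ≤ f u := by nlinarith
        nlinarith
      · nlinarith [mul_nonneg hp.le hx0]
    · nlinarith
  nlinarith [mul_le_mul_of_nonneg_left hx1 hp.le]

lemma IsSlowProfile.norm_deriv_le {r : ℝ} {f : ℝ → ℝ} (hf : IsSlowProfile r f) (u : ℝ) :
    ‖deriv f u‖ ≤ 4 / 3 / r ^ 2 := by
  rw [Real.norm_of_nonneg (hf.deriv_nonneg u)]
  exact hf.deriv_le u

/-! ### Integral curves of the slowed-down field -/

lemma le_of_hasDerivAt_nonpos {q q' : ℝ → ℝ} {a : ℝ} (ha : 0 ≤ a) (hc : ContinuousOn q (Icc 0 a))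
    (hd : ∀ t ∈ Ioo 0 a, HasDerivAt q (q' t) t) (hn : ∀ t ∈ Ioo 0 a, q' t ≤ 0) : q a ≤ q 0 := by
  refine antitoneOn_of_deriv_nonpos (convex_Icc 0 a) hc ?_ ?_ (left_mem_Icc.2 ha)
    (right_mem_Icc.2 ha) ha
  · rw [interior_Icc]
    exact fun t ht => (hd t ht).differentiableAt.differentiableWithinAt
  · rw [interior_Icc]
    exact fun t ht => (hd t ht).deriv ▸ hn t ht

lemma gronwall_Icc {q q' P P' : ℝ → ℝ} {a : ℝ} (ha : 0 ≤ a) (hq : ContinuousOn q (Icc 0 a))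
    (hP : ContinuousOn P (Icc 0 a)) (hq' : ∀ t ∈ Ioo 0 a, HasDerivAt q (q' t) t)
    (hP' : ∀ t ∈ Ioo 0 a, HasDerivAt P (P' t) t) (h : ∀ t ∈ Ioo 0 a, q' t ≤ P' t * q t) :
    q a ≤ Real.exp (P a - P 0) * q 0 := by
  have := le_of_hasDerivAt_nonpos (q := fun t => q t * Real.exp (-P t))
    (q' := fun t => q' t * Real.exp (-P t) + q t * (Real.exp (-P t) * -P' t)) ha
    (hq.mul (Real.continuous_exp.comp_continuousOn hP.neg))
    (fun t ht => (hq' t ht).mul (hP' t ht).neg.exp)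
    (fun t ht => by nlinarith [h t ht, Real.exp_pos (-P t)])
  have e : q a = q a * Real.exp (-P a) * Real.exp (P a) := by
    rw [mul_assoc, ← Real.exp_add]; simp
  rw [e, sub_eq_add_neg, Real.exp_add]
  nlinarith [Real.exp_pos (P a)]

/-- The solution of the slowed-down system has the form `(s₁ e^θ, s₂ e^{-θ})`, where the
clock `θ` solves a scalar equation. Its right-hand side is bounded by `L` and locally Lipschitz, so
the Picard-Lindelöf theorem applies on the whole of `[0, 1]`. -/
lemma IsSlowProfile.exists_clock {r L : ℝ} (hr : 0 < r) (hL : 0 ≤ L) {f : ℝ → ℝ}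
    (hf : IsSlowProfile r f) (s : ℝ × ℝ) :
    ∃ θ : ℝ → ℝ, θ 0 = 0 ∧ ∀ t ∈ Icc (0 : ℝ) 1, HasDerivWithinAt θ
      (L * f ((s.1 * Real.exp (θ t)) ^ 2 + (s.2 * Real.exp (-θ t)) ^ 2)) (Icc 0 1) t := by
  set h : ℝ → ℝ := fun θ => L * f ((s.1 * Real.exp θ) ^ 2 + (s.2 * Real.exp (-θ)) ^ 2) with hh
  have hd : ∀ θ, HasDerivAt h (L * (deriv f ((s.1 * Real.exp θ) ^ 2 + (s.2 * Real.exp (-θ)) ^ 2) *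
      (2 * (s.1 * Real.exp θ) ^ 2 - 2 * (s.2 * Real.exp (-θ)) ^ 2))) θ := fun θ => by
    have h1 : HasDerivAt (fun θ => (s.1 * Real.exp θ) ^ 2 + (s.2 * Real.exp (-θ)) ^ 2)
        (2 * (s.1 * Real.exp θ) ^ 2 - 2 * (s.2 * Real.exp (-θ)) ^ 2) θ := by
      have h2 := ((Real.hasDerivAt_exp θ).const_mul s.1).pow 2
      have h3 := (((Real.hasDerivAt_exp (-θ)).comp θ (hasDerivAt_neg θ)).const_mul s.2).pow 2
      refine (h2.add h3).congr_deriv ?_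
      simp only [Function.comp]
      push_cast
      ring
    exact ((hf.differentiable _).hasDerivAt.comp θ h1).const_mul L
  set K : ℝ := L * (4 / 3 / r ^ 2 * (2 * (s.1 ^ 2 + s.2 ^ 2) * Real.exp L ^ 2)) with hK
  have hK0 : 0 ≤ K := by positivity
  have hlip : LipschitzOnWith (NNReal.mk K hK0) h (Metric.closedBall 0 L) := by
    refine (convex_closedBall (0 : ℝ) L).lipschitzOnWith_of_nnnorm_hasDerivWithin_le
      (fun x _ => (hd x).hasDerivWithinAt) fun θ hθ => ?_
    rw [mem_closedBall_zero_iff, Real.norm_eq_abs, abs_le] at hθ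
    refine NNReal.coe_le_coe.1 ?_
    change ‖_‖ ≤ K
    rw [norm_mul, norm_mul, Real.norm_of_nonneg hL, hK]
    have e1 : Real.exp θ ≤ Real.exp L := Real.exp_le_exp.2 hθ.2
    have e2 : Real.exp (-θ) ≤ Real.exp L := Real.exp_le_exp.2 (by linarith)
    have e3 : (s.1 * Real.exp θ) ^ 2 ≤ s.1 ^ 2 * Real.exp L ^ 2 := by rw [mul_pow]; gcongr
    have e4 : (s.2 * Real.exp (-θ)) ^ 2 ≤ s.2 ^ 2 * Real.exp L ^ 2 := by rw [mul_pow]; gcongr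
    gcongr
    · exact hf.norm_deriv_le _
    · rw [Real.norm_eq_abs, abs_le]
      constructor <;> nlinarith [sq_nonneg (s.1 * Real.exp θ), sq_nonneg (s.2 * Real.exp (-θ))]
  have hPL : IsPicardLindelof (fun _ => h) (⟨0, by simp⟩ : Icc (0 : ℝ) 1) 0
      (NNReal.mk L hL) 0 (NNReal.mk L hL) (NNReal.mk K hK0) := by
    refine ⟨fun _ _ => hlip, fun _ _ => continuousOn_const, fun _ _ x _ => ?_, ?_⟩
    · show ‖L * f _‖ ≤ L
      rw [Real.norm_of_nonneg (mul_nonneg hL (hf.pos _).le)]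
      exact mul_le_of_le_one_right hL (hf.le_one _)
    · simp
  exact hPL.exists_eq_forall_mem_Icc_hasDerivWithinAt₀

/-- The squared norm of a point in eigencoordinates. -/
def nsq (z : ℝ × ℝ) : ℝ := z.1 ^ 2 + z.2 ^ 2

lemma nsq_nonneg (z : ℝ × ℝ) : 0 ≤ nsq z := by unfold nsq; positivity

lemma nsq_eq_zero {z : ℝ × ℝ} (h : nsq z ≤ 0) : z = 0 := by
  have h1 : z.1 ^ 2 + z.2 ^ 2 ≤ 0 := h
  ext <;> simp <;> nlinarith [sq_nonneg z.1, sq_nonneg z.2]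

/-- The bounded increasing function `x ↦ x / (1 + x)`, whose value at `x = s₁² / r²` measures how far
an orbit has progressed through the slow-down disk. -/
def sat (x : ℝ) : ℝ := x / (1 + x)

lemma hasDerivAt_sat {x : ℝ} (hx : 0 ≤ x) : HasDerivAt sat (1 / (1 + x) ^ 2) x := by
  have h := (hasDerivAt_id x).div ((hasDerivAt_id x).const_add 1) (by simp; positivity)
  refine h.congr_deriv ?_
  simp

lemma sat_le_one {x : ℝ} (hx : 0 ≤ x) : sat x ≤ 1 := by
  unfold sat; rw [div_le_one (by positivity)]; linarith

/-- The excess rate of expansion at the point `z` allowed by `IsSlowProfile.rate_le`. -/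
def excess (r : ℝ) (f : ℝ → ℝ) (z : ℝ × ℝ) : ℝ :=
  f (z.1 ^ 2 + z.2 ^ 2) * (z.1 ^ 2 / r ^ 2 / (1 + z.1 ^ 2 / r ^ 2) ^ 2)

namespace IsSlowProfile

variable {r L : ℝ} {f : ℝ → ℝ}

lemma excess_le_one (hf : IsSlowProfile r f) (z : ℝ × ℝ) : excess r f z ≤ 1 := by
  have hx : 0 ≤ z.1 ^ 2 / r ^ 2 := by positivity
  have h1 : z.1 ^ 2 / r ^ 2 / (1 + z.1 ^ 2 / r ^ 2) ^ 2 ≤ 1 := by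
    rw [div_le_one (by positivity)]; nlinarith
  exact mul_le_one₀ (hf.le_one _) (by positivity) h1

lemma continuous_excess (hf : IsSlowProfile r f) : Continuous (excess r f) := by
  have h := hf.differentiable.continuous
  unfold excess
  refine (h.comp (by fun_prop)).mul (Continuous.div (by fun_prop) (by fun_prop) fun z => ?_)
  positivity

/-- A one-sided Lipschitz estimate for the slowed-down field. The off-diagonal part of its
differential is antisymmetric in eigencoordinates, so only the rate `ψ + 2 s₁² ψ'` counts. -/
lemma exists_inner_slowField_le (hf : IsSlowProfile r f) (hr : 0 < r) (hL : 0 ≤ L) (z w : ℝ × ℝ) :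
    ∃ c ∈ Ioo (0 : ℝ) 1,
      w.1 * ((slowField L f (z + w)).1 - (slowField L f z).1) +
        w.2 * ((slowField L f (z + w)).2 - (slowField L f z).2) ≤
      L * (1 + 400 * excess r f (z + c • w)) * nsq w := by
  set k : ℝ → ℝ := fun τ => w.1 * ((z.1 + τ * w.1) *
      f ((z.1 + τ * w.1) ^ 2 + (z.2 + τ * w.2) ^ 2) * L) -
    w.2 * ((z.2 + τ * w.2) * f ((z.1 + τ * w.1) ^ 2 + (z.2 + τ * w.2) ^ 2) * L) with hk
  set k' : ℝ → ℝ := fun τ => L * ((w.1 ^ 2 - w.2 ^ 2) *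
      f ((z.1 + τ * w.1) ^ 2 + (z.2 + τ * w.2) ^ 2) +
      2 * deriv f ((z.1 + τ * w.1) ^ 2 + (z.2 + τ * w.2) ^ 2) *
        (w.1 ^ 2 * (z.1 + τ * w.1) ^ 2 - w.2 ^ 2 * (z.2 + τ * w.2) ^ 2)) with hk'
  have hd : ∀ τ, HasDerivAt k (k' τ) τ := fun τ => by
    have h1 : HasDerivAt (fun τ : ℝ => z.1 + τ * w.1) w.1 τ := by
      simpa using ((hasDerivAt_id τ).mul_const w.1).const_add z.1
    have h2 : HasDerivAt (fun τ : ℝ => z.2 + τ * w.2) w.2 τ := by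
      simpa using ((hasDerivAt_id τ).mul_const w.2).const_add z.2
    have h3 := (hf.differentiable _).hasDerivAt.comp τ ((h1.pow 2).add (h2.pow 2))
    have h4 := (((h1.mul h3).mul_const L).const_mul w.1).sub
      (((h2.mul h3).mul_const L).const_mul w.2)
    refine h4.congr_deriv ?_
    simp only [Function.comp, Pi.add_apply, Pi.pow_apply, hk']
    push_cast
    ring
  obtain ⟨c, hc, hcd⟩ := exists_hasDerivAt_eq_slope k k' one_pos
    (fun τ _ => (hd τ).continuousAt.continuousWithinAt) fun τ _ => hd τ
  refine ⟨c, hc, ?_⟩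
  have e1 : w.1 * ((slowField L f (z + w)).1 - (slowField L f z).1) +
      w.2 * ((slowField L f (z + w)).2 - (slowField L f z).2) = k' c := by
    rw [hcd]; simp only [slowField, hk, Prod.fst_add, Prod.snd_add]; simp; ring
  rw [e1]
  have hrate := hf.rate_le hr (z + c • w)
  have hp := hf.pos ((z.1 + c * w.1) ^ 2 + (z.2 + c * w.2) ^ 2)
  have hn := hf.deriv_nonneg ((z.1 + c * w.1) ^ 2 + (z.2 + c * w.2) ^ 2)
  simp only [hk', excess, nsq, Prod.fst_add, Prod.snd_add, Prod.smul_fst, Prod.smul_snd,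
    smul_eq_mul] at hrate ⊢
  rw [mul_assoc L (1 + _)]
  refine mul_le_mul_of_nonneg_left ?_ hL
  set F := f ((z.1 + c * w.1) ^ 2 + (z.2 + c * w.2) ^ 2)
  set D := deriv f ((z.1 + c * w.1) ^ 2 + (z.2 + c * w.2) ^ 2)
  set y1 := z.1 + c * w.1
  set y2 := z.2 + c * w.2
  set X := 1 + 400 * (F * (y1 ^ 2 / r ^ 2 / (1 + y1 ^ 2 / r ^ 2) ^ 2))
  have hX : 0 ≤ X := by positivity
  have i1 : w.1 ^ 2 * (F + 2 * y1 ^ 2 * D) ≤ w.1 ^ 2 * X :=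
    mul_le_mul_of_nonneg_left hrate (sq_nonneg _)
  have i2 : 0 ≤ w.2 ^ 2 * F := by positivity
  have i3 : 0 ≤ w.2 ^ 2 * y2 ^ 2 * D := by positivity
  have i4 : 0 ≤ w.2 ^ 2 * X := by positivity
  nlinarith

section Curves

variable {γ δ : ℝ → ℝ × ℝ}

lemma continuousOn_nsq_sub (hγ : IsIntegralCurveOn γ (fun _ => slowField L f) (Icc 0 1))
    (hδ : IsIntegralCurveOn δ (fun _ => slowField L f) (Icc 0 1)) :
    ContinuousOn (fun t => nsq (δ t - γ t)) (Icc 0 1) := by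
  have h1 : ContinuousOn γ (Icc 0 1) := fun t ht => (hγ t ht).continuousWithinAt
  have h2 : ContinuousOn δ (Icc 0 1) := fun t ht => (hδ t ht).continuousWithinAt
  unfold nsq
  fun_prop

lemma hasDerivAt_nsq_sub (hγ : IsIntegralCurveOn γ (fun _ => slowField L f) (Icc 0 1))
    (hδ : IsIntegralCurveOn δ (fun _ => slowField L f) (Icc 0 1)) {t : ℝ} (ht : t ∈ Ioo (0 : ℝ) 1) :
    HasDerivAt (fun t => nsq (δ t - γ t))
      (2 * ((δ t - γ t).1 * ((slowField L f (δ t)).1 - (slowField L f (γ t)).1) +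
        (δ t - γ t).2 * ((slowField L f (δ t)).2 - (slowField L f (γ t)).2))) t := by
  have ht' := Ioo_subset_Icc_self ht
  have hN := Icc_mem_nhds ht.1 ht.2
  have h := ((hδ t ht').hasDerivAt hN).sub ((hγ t ht').hasDerivAt hN)
  have h1 := (hasFDerivAt_fst.comp_hasDerivAt t h).pow 2
  have h2 := (hasFDerivAt_snd.comp_hasDerivAt t h).pow 2
  refine (h1.add h2).congr_deriv ?_
  simp
  ring

/-- A crude bound for the divergence of two integral curves; it also yields uniqueness. -/
lemma nsq_sub_le_crude (hf : IsSlowProfile r f) (hr : 0 < r) (hL : 0 ≤ L)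
    (hγ : IsIntegralCurveOn γ (fun _ => slowField L f) (Icc 0 1))
    (hδ : IsIntegralCurveOn δ (fun _ => slowField L f) (Icc 0 1)) {a : ℝ} (ha : a ∈ Icc (0 : ℝ) 1) :
    nsq (δ a - γ a) ≤ Real.exp (802 * L) * nsq (δ 0 - γ 0) := by
  have h := gronwall_Icc (q := fun t => nsq (δ t - γ t)) (P := fun t => 802 * L * t)
    (P' := fun _ => 802 * L) ha.1
    ((continuousOn_nsq_sub hγ hδ).mono (Icc_subset_Icc_right ha.2)) (by fun_prop)
    (fun t ht => hasDerivAt_nsq_sub hγ hδ ⟨ht.1, ht.2.trans_le ha.2⟩)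
    (fun t _ => by simpa using (hasDerivAt_id t).const_mul (802 * L)) fun t _ => by
      obtain ⟨c, -, hc⟩ := hf.exists_inner_slowField_le hr hL (γ t) (δ t - γ t)
      rw [add_sub_cancel] at hc
      have h1 := hf.excess_le_one (γ t + c • (δ t - γ t))
      have h2 : L * (1 + 400 * excess r f (γ t + c • (δ t - γ t))) * nsq (δ t - γ t) ≤
          L * 401 * nsq (δ t - γ t) := by
        have := nsq_nonneg (δ t - γ t)
        gcongr
        linarith
      linarith
  refine h.trans ?_
  have := nsq_nonneg (δ 0 - γ 0)
  gcongr
  nlinarith [ha.2]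

/-- Two integral curves that start close together diverge at most at the rate `L + ε / 2`, apart
from a bounded correction which depends only on the end points of the first curve. -/
lemma exists_nsq_sub_le (hf : IsSlowProfile r f) (hr : 0 < r) (hL : 0 ≤ L)
    (hγ : IsIntegralCurveOn γ (fun _ => slowField L f) (Icc 0 1)) {ε : ℝ} (hε : 0 < ε) :
    ∃ ρ > 0, ∀ δ : ℝ → ℝ × ℝ, IsIntegralCurveOn δ (fun _ => slowField L f) (Icc 0 1) →
      nsq (δ 0 - γ 0) < ρ → nsq (δ 1 - γ 1) ≤
        Real.exp (2 * L + ε + 400 * (sat ((γ 1).1 ^ 2 / r ^ 2) - sat ((γ 0).1 ^ 2 / r ^ 2))) *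
          nsq (δ 0 - γ 0) := by
  have hγc : ContinuousOn γ (Icc 0 1) := fun t ht => (hγ t ht).continuousWithinAt
  have hK : IsCompact (γ '' Icc 0 1) := isCompact_Icc.image_of_continuousOn hγc
  have hε1 : 0 < ε / (800 * L + 1) := by positivity
  have hu := hK.uniformContinuousAt_of_continuousAt (excess r f)
    (fun z _ => hf.continuous_excess.continuousAt) (Metric.dist_mem_uniformity hε1)
  obtain ⟨d, hd, hd'⟩ := Metric.mem_uniformity_dist.1 hu
  refine ⟨d ^ 2 * Real.exp (-(802 * L)), by positivity, fun δ hδ h0 => ?_⟩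
  have hclose : ∀ t ∈ Icc (0 : ℝ) 1, nsq (δ t - γ t) < d ^ 2 := fun t ht => by
    calc _ ≤ _ := hf.nsq_sub_le_crude hr hL hγ hδ ht
      _ < Real.exp (802 * L) * (d ^ 2 * Real.exp (-(802 * L))) := by gcongr
      _ = d ^ 2 * Real.exp (802 * L + -(802 * L)) := by rw [Real.exp_add]; ring
      _ = d ^ 2 := by simp
  have hx : ∀ z : ℝ × ℝ, 0 ≤ z.1 ^ 2 / r ^ 2 := fun z => by positivity
  have h := gronwall_Icc (q := fun t => nsq (δ t - γ t))
    (P := fun t => (2 * L + ε) * t + 400 * sat ((γ t).1 ^ 2 / r ^ 2))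
    (P' := fun t => (2 * L + ε) + 400 * (2 * L * excess r f (γ t))) zero_le_one
    (continuousOn_nsq_sub hγ hδ) ?_ (fun t ht => hasDerivAt_nsq_sub hγ hδ ht)
    (fun t ht => ?_) fun t ht => ?_
  · convert h using 3
    ring
  · have h1 : ContinuousOn (fun t => sat ((γ t).1 ^ 2 / r ^ 2)) (Icc 0 1) := fun t ht =>
      (hasDerivAt_sat (hx (γ t))).continuousAt.comp_continuousWithinAt
        (f := fun t => (γ t).1 ^ 2 / r ^ 2) (((hγc.fst.pow 2).div_const (r ^ 2)) t ht)
    fun_prop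
  · have ht' := Ioo_subset_Icc_self ht
    have h1 := (hasFDerivAt_fst.comp_hasDerivAt t
      ((hγ t ht').hasDerivAt (Icc_mem_nhds ht.1 ht.2))).pow 2
    have h2 := (hasDerivAt_sat (hx (γ t))).comp t (h1.div_const (r ^ 2))
    have h3 := ((hasDerivAt_id t).const_mul (2 * L + ε)).add (h2.const_mul 400)
    refine h3.congr_deriv ?_
    simp [slowField, excess]
    field_simp
  · obtain ⟨c, hc, hcl⟩ := hf.exists_inner_slowField_le hr hL (γ t) (δ t - γ t)
    rw [add_sub_cancel] at hcl
    have ht' := Ioo_subset_Icc_self ht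
    have hn := hclose t ht'
    have hdist : dist (γ t) (γ t + c • (δ t - γ t)) < d := by
      have h1 : |(δ t - γ t).1| < d := abs_lt_of_sq_lt_sq
        (by unfold nsq at hn; nlinarith [sq_nonneg (δ t - γ t).2]) hd.le
      have h2 : |(δ t - γ t).2| < d := abs_lt_of_sq_lt_sq
        (by unfold nsq at hn; nlinarith [sq_nonneg (δ t - γ t).1]) hd.le
      rw [dist_self_add_right, norm_smul, Real.norm_of_nonneg hc.1.le]
      refine (mul_le_of_le_one_left (norm_nonneg _) hc.2.le).trans_lt ?_
      rw [Prod.norm_def]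
      exact max_lt h1 h2
    have hex := hd' hdist (mem_image_of_mem γ ht')
    simp only [Set.mem_ofPred_eq, Real.dist_eq] at hex
    have hex' := (abs_lt.1 hex).1
    have hLε : 800 * L * (ε / (800 * L + 1)) ≤ ε := by
      rw [mul_div_assoc', div_le_iff₀ (by positivity)]; nlinarith
    have hn0 := nsq_nonneg (δ t - γ t)
    have h5 : 2 * (L * (1 + 400 * excess r f (γ t + c • (δ t - γ t)))) ≤
        2 * L + ε + 400 * (2 * L * excess r f (γ t)) := by
      nlinarith [mul_le_mul_of_nonneg_left hex'.le hL]
    have h6 := mul_le_mul_of_nonneg_right h5 hn0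
    linarith

end Curves

/-! ### The time-one map -/

/-- The time-one map in terms of the clock: `timeOne` is `(s₁ e^θ, s₂ e^{-θ})` at time `1`, and
these formulas define an integral curve on the whole of `[0, 1]`. -/
lemma exists_clock_timeOne (hf : IsSlowProfile r f) (hr : 0 < r) (hL : 0 ≤ L) (s : ℝ × ℝ) :
    ∃ θ : ℝ → ℝ, θ 0 = 0 ∧
      (∀ t ∈ Icc (0 : ℝ) 1, HasDerivWithinAt θ
        (L * f ((s.1 * Real.exp (θ t)) ^ 2 + (s.2 * Real.exp (-θ t)) ^ 2)) (Icc 0 1) t) ∧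
      IsIntegralCurveOn (fun t => (s.1 * Real.exp (θ t), s.2 * Real.exp (-θ t)))
        (fun _ => slowField L f) (Icc 0 1) ∧
      timeOne L f s = (s.1 * Real.exp (θ 1), s.2 * Real.exp (-θ 1)) := by
  obtain ⟨θ, h0, hθ⟩ := hf.exists_clock hr hL s
  have hcurve : IsIntegralCurveOn (fun t => (s.1 * Real.exp (θ t), s.2 * Real.exp (-θ t)))
      (fun _ => slowField L f) (Icc 0 1) := fun t ht => by
    have h1 := (hθ t ht).exp.const_mul s.1
    have h2 := (hθ t ht).neg.exp.const_mul s.2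
    refine (h1.prodMk h2).congr_deriv ?_
    simp only [slowField, Prod.mk.injEq, Pi.neg_apply]
    constructor <;> ring
  refine ⟨θ, h0, hθ, hcurve, ?_⟩
  have hex : ∃ γ : ℝ → ℝ × ℝ, γ 0 = s ∧
      IsIntegralCurveOn γ (fun _ => slowField L f) (Icc 0 1) := ⟨_, by simp [h0], hcurve⟩
  rw [timeOne, dif_pos hex]
  have h := hf.nsq_sub_le_crude hr hL hcurve hex.choose_spec.2 (right_mem_Icc.2 zero_le_one)
  rw [hex.choose_spec.1] at h
  exact sub_eq_zero.1 (nsq_eq_zero (h.trans (by simp [h0, nsq])))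

/-- The clock runs forward with speed at most `L`. -/
lemma clock_mem_Icc (hf : IsSlowProfile r f) (hL : 0 ≤ L) {g θ : ℝ → ℝ} (h0 : θ 0 = 0)
    (hθ : ∀ t ∈ Icc (0 : ℝ) 1, HasDerivWithinAt θ (L * f (g t)) (Icc 0 1) t) {a : ℝ}
    (ha : a ∈ Icc (0 : ℝ) 1) : θ a ∈ Icc 0 L := by
  have hc : ContinuousOn θ (Icc 0 a) := fun t ht =>
    ((hθ t (Icc_subset_Icc_right ha.2 ht)).continuousWithinAt).mono (Icc_subset_Icc_right ha.2)
  have hd : ∀ t ∈ Ioo (0 : ℝ) a, HasDerivAt θ (L * f (g t)) t := fun t ht =>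
    (hθ t ⟨ht.1.le, ht.2.le.trans ha.2⟩).hasDerivAt (Icc_mem_nhds ht.1 (ht.2.trans_le ha.2))
  have h1 := le_of_hasDerivAt_nonpos ha.1 hc.neg (fun t ht => (hd t ht).neg)
    fun t _ => neg_nonpos.2 (mul_nonneg hL (hf.pos _).le)
  have h2 := le_of_hasDerivAt_nonpos (q := fun t => θ t - L * t) ha.1
    (hc.sub (by fun_prop)) (fun t ht => (hd t ht).sub ((hasDerivAt_id t).const_mul L))
    fun t _ => by linarith [mul_le_of_le_one_right hL (hf.le_one (g t))]
  simp only [Pi.neg_apply, h0] at h1 h2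
  constructor <;> nlinarith [ha.2]

lemma exists_timeOne_eq (hf : IsSlowProfile r f) (hr : 0 < r) (hL : 0 ≤ L) (s : ℝ × ℝ) :
    ∃ θ ∈ Icc 0 L, timeOne L f s = (s.1 * Real.exp θ, s.2 * Real.exp (-θ)) := by
  obtain ⟨θ, h0, hθ, -, hT⟩ := hf.exists_clock_timeOne hr hL s
  exact ⟨θ 1, hf.clock_mem_Icc hL h0 hθ (right_mem_Icc.2 zero_le_one), hT⟩

/-- An orbit that starts outside the disk of radius `e^L r` does not enter the slow-down disk within
time one, so there the time-one map is linear. -/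
lemma timeOne_eq_linear (hf : IsSlowProfile r f) (hr : 0 < r) (hL : 0 ≤ L) {s : ℝ × ℝ}
    (hs : (Real.exp L * r) ^ 2 ≤ nsq s) :
    timeOne L f s = (s.1 * Real.exp L, s.2 * Real.exp (-L)) := by
  obtain ⟨θ, h0, hθ, -, hT⟩ := hf.exists_clock_timeOne hr hL s
  have hc : ContinuousOn θ (Icc 0 1) := fun t ht => (hθ t ht).continuousWithinAt
  have hd : ∀ t ∈ Ioo (0 : ℝ) 1, HasDerivAt θ _ t := fun t ht =>
    (hθ t (Ioo_subset_Icc_self ht)).hasDerivAt (Icc_mem_nhds ht.1 ht.2)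
  have hbd : ∀ a ∈ Icc (0 : ℝ) 1, θ a ∈ Icc 0 L := fun a ha => hf.clock_mem_Icc hL h0 hθ ha
  have hone : ∀ t ∈ Ioo (0 : ℝ) 1,
      f ((s.1 * Real.exp (θ t)) ^ 2 + (s.2 * Real.exp (-θ t)) ^ 2) = 1 := fun t ht => by
    have ⟨b1, b2⟩ := hbd t (Ioo_subset_Icc_self ht)
    apply hf.eq_one
    have e1 : Real.exp (-L) ≤ Real.exp (θ t) := Real.exp_le_exp.2 (by linarith)
    have e2 : Real.exp (-L) ≤ Real.exp (-θ t) := Real.exp_le_exp.2 (by linarith)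
    have e0 := Real.exp_pos (-L)
    calc r ^ 2 = (Real.exp (-L) * Real.exp L) ^ 2 * r ^ 2 := by rw [← Real.exp_add]; simp
      _ = Real.exp (-L) ^ 2 * (Real.exp L * r) ^ 2 := by ring
      _ ≤ Real.exp (-L) ^ 2 * (s.1 ^ 2 + s.2 ^ 2) := by gcongr; exact hs
      _ = s.1 ^ 2 * Real.exp (-L) ^ 2 + s.2 ^ 2 * Real.exp (-L) ^ 2 := by ring
      _ ≤ s.1 ^ 2 * Real.exp (θ t) ^ 2 + s.2 ^ 2 * Real.exp (-θ t) ^ 2 := by gcongr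
      _ = _ := by ring
  have h2 := le_of_hasDerivAt_nonpos (q := fun t => L * t - θ t) zero_le_one
    (ContinuousOn.sub (by fun_prop) hc)
    (fun t ht => ((hasDerivAt_id t).const_mul L).sub (hd t ht)) fun t ht => by
      rw [hone t ht]; simp
  simp only [h0] at h2
  have h3 := (hbd 1 (right_mem_Icc.2 zero_le_one)).2
  have : θ 1 = L := by linarith
  rw [hT, this]

/-- The infinitesimal expansion of the time-one map, as a statement about nearby points. -/
lemma exists_nsq_timeOne_sub_le (hf : IsSlowProfile r f) (hr : 0 < r) (hL : 0 ≤ L) (s : ℝ × ℝ)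
    {ε : ℝ} (hε : 0 < ε) :
    ∃ ρ > 0, ∀ w : ℝ × ℝ, nsq w < ρ → nsq (timeOne L f (s + w) - timeOne L f s) ≤
      Real.exp (2 * L + ε + 400 * (sat ((timeOne L f s).1 ^ 2 / r ^ 2) - sat (s.1 ^ 2 / r ^ 2))) *
        nsq w := by
  obtain ⟨θ, h0, -, hγ, hT⟩ := hf.exists_clock_timeOne hr hL s
  obtain ⟨ρ, hρ, H⟩ := hf.exists_nsq_sub_le hr hL hγ hε
  refine ⟨ρ, hρ, fun w hw => ?_⟩
  obtain ⟨θ', h0', -, hδ, hT'⟩ := hf.exists_clock_timeOne hr hL (s + w)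
  have e : ((s + w).1 * Real.exp (θ' 0), (s + w).2 * Real.exp (-θ' 0)) -
      (s.1 * Real.exp (θ 0), s.2 * Real.exp (-θ 0)) = w := by
    ext <;> simp [h0, h0']
  have := H _ hδ
  simp only [e] at this
  rw [hT', hT]
  simpa [h0] using this hw

end IsSlowProfile

/-! ### Eigencoordinates on the torus -/

variable {A : Matrix.SpecialLinearGroup (Fin 2) ℤ}

lemma two_lt_tr (hA : 2 < A 0 0 + A 1 1) : 2 < tr A := by
  unfold tr; exact_mod_cast hA

lemma sqrt_disc_pos (hA : 2 < A 0 0 + A 1 1) : 0 < √(tr A ^ 2 - 4) :=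
  Real.sqrt_pos.2 (by nlinarith [two_lt_tr hA])

lemma sq_sqrt_disc (hA : 2 < A 0 0 + A 1 1) : √(tr A ^ 2 - 4) ^ 2 = tr A ^ 2 - 4 :=
  Real.sq_sqrt (by nlinarith [two_lt_tr hA])

lemma exp_bigLambda (hA : 2 < A 0 0 + A 1 1) :
    Real.exp (bigLambda A) = (tr A + √(tr A ^ 2 - 4)) / 2 :=
  Real.exp_log (by linarith [two_lt_tr hA, sqrt_disc_pos hA])

lemma exp_neg_bigLambda (hA : 2 < A 0 0 + A 1 1) :
    Real.exp (-bigLambda A) = (tr A - √(tr A ^ 2 - 4)) / 2 := by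
  have h1 : Real.exp (-bigLambda A) * Real.exp (bigLambda A) = 1 := by rw [← Real.exp_add]; simp
  have h2 : (tr A - √(tr A ^ 2 - 4)) / 2 * Real.exp (bigLambda A) = 1 := by
    rw [exp_bigLambda hA]; nlinarith [sq_sqrt_disc hA]
  exact mul_right_cancel₀ (Real.exp_pos _).ne' (h1.trans h2.symm)

lemma bigLambda_pos (hA : 2 < A 0 0 + A 1 1) : 0 < bigLambda A :=
  Real.log_pos (by linarith [two_lt_tr hA, sqrt_disc_pos hA])

lemma det_eq_one (A : Matrix.SpecialLinearGroup (Fin 2) ℤ) :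
    A 0 0 * A 1 1 - A 0 1 * A 1 0 = 1 := by
  have := A.det_coe
  rwa [Matrix.det_fin_two] at this

lemma upper_ne_zero (hA : 2 < A 0 0 + A 1 1) : (A 0 1 : ℝ) ≠ 0 := by
  intro h
  have h0 : A 0 1 = 0 := by exact_mod_cast h
  have hd := det_eq_one A
  rw [h0] at hd
  have h2 : A 0 0 * A 1 1 = 1 := by linarith
  rcases Int.eq_one_or_neg_one_of_mul_eq_one h2 with h | h <;> rw [h] at h2 hA <;> omega

/-- The linear change from eigencoordinates to `ℝ²`. -/
def eigenLin (A : Matrix.SpecialLinearGroup (Fin 2) ℤ) : (ℝ × ℝ) →ₗ[ℝ] Plane :=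
  (LinearMap.fst ℝ ℝ ℝ).smulRight (vu A) + (LinearMap.snd ℝ ℝ ℝ).smulRight (vs A)

lemma eigenLin_apply (s : ℝ × ℝ) : eigenLin A s = s.1 • vu A + s.2 • vs A := rfl

lemma eigenPoint_eq (s : ℝ × ℝ) : eigenPoint A s = proj (eigenLin A s) := rfl

lemma eigenLin_zero_coord (s : ℝ × ℝ) :
    eigenLin A s 0 = s.1 * (2 * (A 0 1 : ℝ)) + s.2 * (2 * (A 0 1 : ℝ)) := by
  simp [eigenLin_apply, vu, vs]

lemma eigenLin_one_coord (s : ℝ × ℝ) :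
    eigenLin A s 1 = s.1 * (2 * (A 1 1 : ℝ) - tr A + √(tr A ^ 2 - 4)) +
      s.2 * (2 * (A 1 1 : ℝ) - tr A - √(tr A ^ 2 - 4)) := by
  simp [eigenLin_apply, vu, vs]

lemma eigenLin_injective (hA : 2 < A 0 0 + A 1 1) : Function.Injective (eigenLin A) := by
  rw [injective_iff_map_eq_zero]
  intro s hs
  have h0 : eigenLin A s 0 = 0 := by rw [hs]; rfl
  have h1 : eigenLin A s 1 = 0 := by rw [hs]; rfl
  rw [eigenLin_zero_coord] at h0
  rw [eigenLin_one_coord] at h1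
  have hb := upper_ne_zero hA
  have hq := sqrt_disc_pos hA
  have e1 : s.1 + s.2 = 0 := by
    have : (2 * (A 0 1 : ℝ)) * (s.1 + s.2) = 0 := by linarith
    simpa [hb] using this
  have e2 : s.1 - s.2 = 0 := by
    have h3 : √(tr A ^ 2 - 4) * (s.1 - s.2) = 0 := by
      linear_combination h1 - (2 * (A 1 1 : ℝ) - tr A) * e1
    simpa [hq.ne'] using h3
  ext
  · show s.1 = 0
    linarith
  · show s.2 = 0
    linarith

lemma eigenLin_surjective (hA : 2 < A 0 0 + A 1 1) : Function.Surjective (eigenLin A) :=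
  (LinearMap.injective_iff_surjective_of_finrank_eq_finrank (by simp)).1 (eigenLin_injective hA)

lemma continuous_eigenLin : Continuous (eigenLin A) := LinearMap.continuous_of_finiteDimensional _

lemma norm_sq_le_nsq (s : ℝ × ℝ) : ‖s‖ ^ 2 ≤ nsq s := by
  rw [Prod.norm_def, nsq]
  rcases max_cases ‖s.1‖ ‖s.2‖ with ⟨h, -⟩ | ⟨h, -⟩ <;> rw [h, Real.norm_eq_abs, sq_abs] <;>
    nlinarith [sq_nonneg s.1, sq_nonneg s.2]

lemma nsq_le_two_mul_norm_sq (s : ℝ × ℝ) : nsq s ≤ 2 * ‖s‖ ^ 2 := by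
  have h1 : s.1 ^ 2 ≤ ‖s‖ ^ 2 := by
    rw [← sq_abs, ← Real.norm_eq_abs]; gcongr; exact norm_fst_le s
  have h2 : s.2 ^ 2 ≤ ‖s‖ ^ 2 := by
    rw [← sq_abs, ← Real.norm_eq_abs]; gcongr; exact norm_snd_le s
  unfold nsq; linarith

lemma exists_norm_eigenLin_sq_le (A : Matrix.SpecialLinearGroup (Fin 2) ℤ) :
    ∃ M > 0, ∀ s, ‖eigenLin A s‖ ^ 2 ≤ M * nsq s := by
  obtain ⟨C, hC, h⟩ := (LinearMap.toContinuousLinearMap (eigenLin A)).bound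
  refine ⟨C ^ 2, by positivity, fun s => ?_⟩
  calc ‖eigenLin A s‖ ^ 2 ≤ (C * ‖s‖) ^ 2 := by gcongr; exact h s
    _ = C ^ 2 * ‖s‖ ^ 2 := by ring
    _ ≤ _ := by gcongr; exact norm_sq_le_nsq s

lemma exists_nsq_le_norm_eigenLin (hA : 2 < A 0 0 + A 1 1) :
    ∃ M > 0, ∀ s, nsq s ≤ M * ‖eigenLin A s‖ ^ 2 := by
  obtain ⟨K, hK, h⟩ := (eigenLin A).exists_antilipschitzWith
    (LinearMap.ker_eq_bot.2 (eigenLin_injective hA))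
  refine ⟨2 * K ^ 2, by positivity, fun s => ?_⟩
  have h1 : ‖s‖ ≤ K * ‖eigenLin A s‖ := by
    simpa using h.le_mul_dist s 0
  calc nsq s ≤ 2 * ‖s‖ ^ 2 := nsq_le_two_mul_norm_sq s
    _ ≤ 2 * (K * ‖eigenLin A s‖) ^ 2 := by gcongr
    _ = _ := by ring

lemma proj_add (v w : Plane) : proj (v + w) = proj v + proj w := by
  ext i; simp [proj]

lemma continuous_proj : Continuous proj := by
  refine continuous_pi fun i => (AddCircle.continuous_mk' 1).comp ?_
  fun_prop

lemma eigenPoint_add (s t : ℝ × ℝ) : eigenPoint A (s + t) = eigenPoint A s + eigenPoint A t := by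
  rw [eigenPoint_eq, map_add, proj_add]; rfl

lemma continuous_eigenPoint : Continuous (eigenPoint A) := continuous_proj.comp continuous_eigenLin

lemma toralAut_add (p q : Torus) : toralAut A (p + q) = toralAut A p + toralAut A q := by
  ext i; simp [toralAut, Fin.sum_univ_two, smul_add]; abel

lemma toralAut_eigenPoint (hA : 2 < A 0 0 + A 1 1) (s : ℝ × ℝ) :
    toralAut A (eigenPoint A s) =
      eigenPoint A (s.1 * Real.exp (bigLambda A), s.2 * Real.exp (-bigLambda A)) := by
  have hd : (A 0 0 : ℝ) * A 1 1 - A 0 1 * A 1 0 = 1 := by exact_mod_cast det_eq_one A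
  have hq := sq_sqrt_disc hA
  have key : ∀ i, (A i 0 : ℝ) * eigenLin A s 0 + A i 1 * eigenLin A s 1 =
      eigenLin A (s.1 * Real.exp (bigLambda A), s.2 * Real.exp (-bigLambda A)) i := by
    rw [Fin.forall_fin_two]
    simp only [eigenLin_zero_coord, eigenLin_one_coord, exp_bigLambda hA, exp_neg_bigLambda hA]
    set q := √(tr A ^ 2 - 4)
    have ht : tr A = A 0 0 + A 1 1 := rfl
    rw [ht] at hq ⊢
    constructor
    · ring
    · linear_combination (-2 * (s.1 + s.2)) * hd - (s.1 + s.2) / 2 * hq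
  funext i
  change ∑ j, A i j • ((eigenLin A s j : ℝ) : UnitAddCircle) =
    ((eigenLin A (s.1 * Real.exp (bigLambda A), s.2 * Real.exp (-bigLambda A)) i : ℝ) :
      UnitAddCircle)
  rw [← key i, Fin.sum_univ_two, ← AddCircle.coe_zsmul, ← AddCircle.coe_zsmul, ← AddCircle.coe_add]
  simp

lemma rep_proj {w : Plane} (hw : ‖w‖ < 1 / 2) : rep (proj w) = w := by
  ext i
  have h := (PiLp.norm_apply_le w i).trans_lt hw
  rw [Real.norm_eq_abs, abs_lt] at h
  exact AddCircle.equivIco_coe_of_mem ⟨by linarith [h.1], by linarith [h.2]⟩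

lemma exists_eigenPoint_injOn (hA : 2 < A 0 0 + A 1 1) :
    ∃ R > 0, ∀ s t : ℝ × ℝ, nsq s ≤ R ^ 2 → nsq t ≤ R ^ 2 →
      eigenPoint A s = eigenPoint A t → s = t := by
  obtain ⟨M, hM, h⟩ := exists_norm_eigenLin_sq_le A
  have hR : 0 < 1 / (4 * (M + 1)) := by positivity
  refine ⟨1 / (4 * (M + 1)), hR, fun s t hs ht hst => ?_⟩
  have hlt : ∀ s : ℝ × ℝ, nsq s ≤ (1 / (4 * (M + 1))) ^ 2 → ‖eigenLin A s‖ < 1 / 2 := fun s hs => by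
    refine lt_of_pow_lt_pow_left₀ 2 (by norm_num) ?_
    calc _ ≤ M * nsq s := h s
      _ ≤ (M + 1) * (1 / (4 * (M + 1))) ^ 2 :=
        mul_le_mul (by linarith) hs (nsq_nonneg s) (by positivity)
      _ = 1 / (16 * (M + 1)) := by field_simp; ring
      _ < _ := by rw [div_lt_iff₀ (by positivity)]; linarith
  apply eigenLin_injective hA
  rw [← rep_proj (hlt s hs), ← rep_proj (hlt t ht), ← eigenPoint_eq, ← eigenPoint_eq, hst]

/-! ### Infinitesimal expansion on the torus -/

/-- In eigencoordinates centred at `p` and at `f p`, the map `f` multiplies small squared distances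
to the centre by at most `c`. This bounds the differential of `f` at `p` but, unlike a bound on
`torusDeriv`, is stable under composition without any differentiability. -/
def ExpandsAtMost (A : Matrix.SpecialLinearGroup (Fin 2) ℤ) (f : Torus → Torus) (p : Torus)
    (c : ℝ) : Prop :=
  ∃ ρ > 0, ∀ w : ℝ × ℝ, nsq w < ρ →
    ∃ w', f (p + eigenPoint A w) = f p + eigenPoint A w' ∧ nsq w' ≤ c * nsq w

lemma ExpandsAtMost.comp {f g : Torus → Torus} {p : Torus} {c d : ℝ} (hd : 0 ≤ d) (hc : 0 < c)
    (hg : ExpandsAtMost A g (f p) d) (hf : ExpandsAtMost A f p c) :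
    ExpandsAtMost A (g ∘ f) p (d * c) := by
  obtain ⟨ρ, hρ, hf⟩ := hf
  obtain ⟨σ, hσ, hg⟩ := hg
  refine ⟨min ρ (σ / c), by positivity, fun w hw => ?_⟩
  obtain ⟨w', h1, h2⟩ := hf w (hw.trans_le (min_le_left _ _))
  have h3 : c * nsq w < σ := by
    have := hw.trans_le (min_le_right _ _)
    rw [lt_div_iff₀ hc] at this
    linarith
  obtain ⟨w'', h4, h5⟩ := hg w' (h2.trans_lt h3)
  refine ⟨w'', by simp [h1, h4], h5.trans ?_⟩
  rw [mul_assoc]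
  gcongr

lemma ExpandsAtMost.mono {f : Torus → Torus} {p : Torus} {c d : ℝ} (hf : ExpandsAtMost A f p c)
    (h : c ≤ d) : ExpandsAtMost A f p d := by
  obtain ⟨ρ, hρ, hf⟩ := hf
  refine ⟨ρ, hρ, fun w hw => ?_⟩
  obtain ⟨w', h1, h2⟩ := hf w hw
  exact ⟨w', h1, h2.trans (mul_le_mul_of_nonneg_right h (nsq_nonneg w))⟩

/-- The coboundary `Φ ∘ f - Φ` telescopes along orbits. -/
lemma ExpandsAtMost.iterate {f : Torus → Torus} {B : ℝ} {Φ : Torus → ℝ}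
    (hf : ∀ p, ExpandsAtMost A f p (Real.exp (B + Φ (f p) - Φ p))) (n : ℕ) (p : Torus) :
    ExpandsAtMost A f^[n] p (Real.exp (n * B + Φ (f^[n] p) - Φ p)) := by
  induction n with
  | zero => exact ⟨1, one_pos, fun w _ => ⟨w, by simp⟩⟩
  | succ n ih =>
    rw [Function.iterate_succ']
    refine ((hf _).comp (Real.exp_pos _).le (Real.exp_pos _) ih).mono ?_
    rw [← Real.exp_add]
    refine Real.exp_le_exp.2 (le_of_eq ?_)
    simp only [Function.comp]
    push_cast
    ring

lemma exists_norm_torusDeriv_le (hA : 2 < A 0 0 + A 1 1) :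
    ∃ M > 0, ∀ (f : Torus → Torus) (p : Torus) (c : ℝ), 0 < c → ExpandsAtMost A f p (c ^ 2) →
      ‖torusDeriv f p‖ ≤ M * c := by
  obtain ⟨M, hM, h1⟩ := exists_norm_eigenLin_sq_le A
  obtain ⟨N, hN, h2⟩ := exists_nsq_le_norm_eigenLin hA
  refine ⟨√(M * N), by positivity, fun f p c hc ⟨ρ, hρ, hf⟩ => ?_⟩
  have hproj0 : proj 0 = 0 := by ext i; simp [proj]
  have hrep0 : rep 0 = 0 := by rw [← hproj0, rep_proj (by simp)]
  refine norm_fderiv_le_of_lip' ℝ (by positivity) ?_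
  have hN1 : 0 < ρ / N := by positivity
  have hN2 : 0 < 1 / 4 / (M * (c ^ 2 * N)) := by positivity
  have hcont : Tendsto (fun w : Plane => ‖w‖ ^ 2) (𝓝 0) (𝓝 0) := by
    have : Continuous fun w : Plane => ‖w‖ ^ 2 := by fun_prop
    simpa using this.tendsto 0
  filter_upwards [hcont.eventually (gt_mem_nhds hN1), hcont.eventually (gt_mem_nhds hN2)]
    with w hw1 hw2
  obtain ⟨s, rfl⟩ := eigenLin_surjective hA w
  rw [lt_div_iff₀ hN] at hw1
  rw [lt_div_iff₀ (by positivity)] at hw2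
  obtain ⟨w', h3, h4⟩ := hf s (by linarith [h2 s])
  have h5 : ‖eigenLin A w'‖ ^ 2 ≤ M * (c ^ 2 * N) * ‖eigenLin A s‖ ^ 2 := by
    calc _ ≤ M * nsq w' := h1 w'
      _ ≤ M * (c ^ 2 * (N * ‖eigenLin A s‖ ^ 2)) := by
        gcongr
        exact h4.trans (by gcongr; exact h2 s)
      _ = _ := by ring
  have h6 : ‖eigenLin A w'‖ < 1 / 2 := lt_of_pow_lt_pow_left₀ 2 (by norm_num) (by linarith)
  rw [← eigenPoint_eq, h3, hproj0, add_zero, sub_self, hrep0, add_sub_cancel_left, eigenPoint_eq,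
    rep_proj h6, sub_zero, sub_zero]
  refine (pow_le_pow_iff_left₀ (norm_nonneg _) (by positivity) two_ne_zero).1 ?_
  rw [mul_pow, mul_pow, Real.sq_sqrt (by positivity)]
  linarith

/-- If the iterates expand squared distances by at most `e^{nB + C}`, then all Lyapunov exponents
are at most `B / 2`. The assumption `0 ≤ B` covers vectors killed by the differential, for which the
logarithm has the value `0`. -/
lemma lyapunovExponent_le (hA : 2 < A 0 0 + A 1 1) {f : Torus → Torus} {p : Torus} {B C : ℝ}
    (hB : 0 ≤ B) (hf : ∀ n : ℕ, ExpandsAtMost A f^[n] p (Real.exp (n * B + C))) (v : Plane) :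
    lyapunovExponent f p v ≤ ((B / 2 : ℝ) : EReal) := by
  obtain ⟨M, hM, h⟩ := exists_norm_torusDeriv_le hA
  set D : ℝ := |Real.log (M * ‖v‖)| + |C| with hD
  have hbound : ∀ n : ℕ, Real.log ‖torusDeriv f^[n] p v‖ ≤ D + n * (B / 2) := fun n => by
    rcases (norm_nonneg (torusDeriv f^[n] p v)).eq_or_lt with h0 | h0
    · rw [← h0, Real.log_zero]; positivity
    have h1 := h _ p (Real.exp ((n * B + C) / 2)) (Real.exp_pos _) (by
      rw [← Real.exp_nat_mul]; convert hf n using 2; push_cast; ring)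
    have h2 : ‖torusDeriv f^[n] p v‖ ≤ M * ‖v‖ * Real.exp ((n * B + C) / 2) := by
      calc _ ≤ ‖torusDeriv f^[n] p‖ * ‖v‖ := ContinuousLinearMap.le_opNorm _ _
        _ ≤ M * Real.exp ((n * B + C) / 2) * ‖v‖ := by gcongr
        _ = _ := by ring
    have h3 : 0 < M * ‖v‖ := pos_of_mul_pos_left (h0.trans_le h2) (Real.exp_pos _).le
    have h4 := Real.log_le_log h0 h2
    rw [Real.log_mul h3.ne' (Real.exp_pos _).ne', Real.log_exp] at h4
    have h5 := le_abs_self (Real.log (M * ‖v‖))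
    have h6 := le_abs_self C
    have h7 := abs_nonneg C
    linarith
  have hlim : Tendsto (fun n : ℕ => ((D / n + B / 2 : ℝ) : EReal)) atTop
      (𝓝 ((B / 2 : ℝ) : EReal)) := by
    refine (continuous_coe_real_ereal.tendsto _).comp ?_
    simpa using (tendsto_const_div_atTop_nhds_zero_nat D).add_const (B / 2)
  rw [lyapunovExponent, ← hlim.limsup_eq]
  refine limsup_le_limsup ?_
  filter_upwards [eventually_gt_atTop 0] with n hn
  have hn' : (0 : ℝ) < n := by exact_mod_cast hn
  rw [EReal.coe_le_coe_iff]
  calc _ ≤ (D + n * (B / 2)) / n := by gcongr; exact hbound n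
    _ = _ := by field_simp

/-! ### The potential -/

/-- The potential as a function of `x = s₁² / r²`: it gains `400` while an orbit crosses the
slow-down disk and gives it back at the slow rate `δ` per unit of `log (1 + x)`. -/
def potential (δ x : ℝ) : ℝ := max 0 (400 * sat x - δ * Real.log (1 + x))

lemma potential_nonneg (δ x : ℝ) : 0 ≤ potential δ x := le_max_left _ _

/-- Where the potential has been used up, the saturating function has almost reached its limit. -/
lemma sat_sub_le_of_potential_eq_zero {δ x y : ℝ} (hδ : 0 ≤ δ) (hx : 0 < x) (hy : 0 ≤ y)
    (h : potential δ x = 0) : 400 * (sat y - sat x) ≤ δ := by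
  have h1 : 400 * sat x - δ * Real.log (1 + x) ≤ 0 := h ▸ le_max_right _ _
  have h2 : Real.log (1 + x) ≤ x := by
    have := Real.log_le_sub_one_of_pos (show 0 < 1 + x by linarith)
    linarith
  have h3 : 400 * (1 / (1 + x)) * x ≤ δ * x := by
    have := mul_le_mul_of_nonneg_left h2 hδ
    unfold sat at h1
    calc _ = 400 * (x / (1 + x)) := by ring
      _ ≤ _ := by linarith
  have h4 := le_of_mul_le_mul_right h3 hx
  have h5 : 1 - sat x = 1 / (1 + x) := by unfold sat; field_simp; ring
  linarith [sat_le_one hy]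

lemma sat_sub_le_potential_sub {L δ x y : ℝ} (hL : 0 ≤ L) (hδ : 0 ≤ δ) (hx : 0 ≤ x) (hxy : x ≤ y)
    (hy : y ≤ Real.exp (2 * L) * x) :
    400 * (sat y - sat x) ≤ potential δ y - potential δ x + (2 * L + 1) * δ := by
  have hLδ : 0 ≤ L * δ := by positivity
  rcases le_total (400 * sat x - δ * Real.log (1 + x)) 0 with h | h
  · have h0 : potential δ x = 0 := max_eq_left h
    rcases hx.eq_or_lt with rfl | hx'
    · have : y = 0 := by linarith
      subst this
      nlinarith
    · have := sat_sub_le_of_potential_eq_zero hδ hx' (hx.trans hxy) h0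
      have := potential_nonneg δ y
      rw [h0]
      linarith
  · have h0 : potential δ x = _ := max_eq_right h
    have h1 : 400 * sat y - δ * Real.log (1 + y) ≤ potential δ y := le_max_right _ _
    have h2 : Real.log (1 + y) ≤ 2 * L + Real.log (1 + x) := by
      rw [← Real.log_exp (2 * L), ← Real.log_mul (Real.exp_pos _).ne' (by positivity)]
      have : 1 ≤ Real.exp (2 * L) := Real.one_le_exp (by positivity)
      exact Real.log_le_log (by linarith) (by linarith)
    have h3 := mul_le_mul_of_nonneg_left h2 hδ
    rw [h0]
    linarith

lemma potential_eq_zero {δ x : ℝ} (hδ : 0 < δ) (hx : Real.exp (400 / δ) ≤ x) :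
    potential δ x = 0 := by
  have h0 : 0 < x := (Real.exp_pos _).trans_le hx
  refine max_eq_left ?_
  have h1 : 400 / δ ≤ Real.log (1 + x) := by
    rw [Real.le_log_iff_exp_le (by linarith)]; linarith
  rw [div_le_iff₀ hδ] at h1
  linarith [sat_le_one h0.le]

open Classical in
/-- The potential on the torus: `potential δ (s₁² / r²)` at the point with eigencoordinates `s` in
the open disk of radius `R`, and `0` outside. -/
def torusPotential (A : Matrix.SpecialLinearGroup (Fin 2) ℤ) (R r δ : ℝ) (p : Torus) : ℝ :=
  if h : ∃ s : ℝ × ℝ, nsq s < R ^ 2 ∧ eigenPoint A s = p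
  then potential δ (h.choose.1 ^ 2 / r ^ 2) else 0

lemma torusPotential_nonneg (R r δ : ℝ) (p : Torus) : 0 ≤ torusPotential A R r δ p := by
  unfold torusPotential
  split_ifs
  · exact potential_nonneg _ _
  · exact le_rfl

section Embedded

variable {R r δ : ℝ} {ψ : ℝ → ℝ}

lemma torusPotential_eigenPoint (hinj : ∀ s t : ℝ × ℝ, nsq s ≤ R ^ 2 → nsq t ≤ R ^ 2 →
      eigenPoint A s = eigenPoint A t → s = t) {s : ℝ × ℝ} (hs : nsq s < R ^ 2) :
    torusPotential A R r δ (eigenPoint A s) = potential δ (s.1 ^ 2 / r ^ 2) := by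
  have h : ∃ t : ℝ × ℝ, nsq t < R ^ 2 ∧ eigenPoint A t = eigenPoint A s := ⟨s, hs, rfl⟩
  have e := hinj _ s h.choose_spec.1.le hs.le h.choose_spec.2
  rw [torusPotential, dif_pos h, e]

/-- In eigencoordinates the slowed-down map is the time-one map, on any disk which embeds in the
torus and contains `D_{r₁}`. -/
lemma slowedMap_eigenPoint (hA : 2 < A 0 0 + A 1 1) (hinj : ∀ s t : ℝ × ℝ, nsq s ≤ R ^ 2 →
      nsq t ≤ R ^ 2 → eigenPoint A s = eigenPoint A t → s = t) (hr : 0 < r)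
    (hψ : IsSlowProfile r ψ) (hR : 2 * Real.exp (bigLambda A) * r ≤ R) {s : ℝ × ℝ}
    (hs : nsq s ≤ R ^ 2) :
    slowedMap A r ψ (eigenPoint A s) = eigenPoint A (timeOne (bigLambda A) ψ s) := by
  have hE := Real.exp_pos (bigLambda A)
  have hdisk : ∀ t ∈ disk (2 * Real.exp (bigLambda A) * r), nsq t ≤ R ^ 2 := fun t ht =>
    le_trans ht (pow_le_pow_left₀ (by positivity) hR 2)
  by_cases h : ∃ t ∈ disk (2 * Real.exp (bigLambda A) * r), eigenPoint A t = eigenPoint A s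
  · rw [slowedMap, dif_pos h, hinj _ s (hdisk _ h.choose_spec.1) hs h.choose_spec.2]
  · rw [slowedMap, dif_neg h, toralAut_eigenPoint hA]
    have hs' : ¬ nsq s ≤ (2 * Real.exp (bigLambda A) * r) ^ 2 := fun hs' => h ⟨s, hs', rfl⟩
    rw [hψ.timeOne_eq_linear hr (bigLambda_pos hA).le]
    nlinarith [sq_nonneg (Real.exp (bigLambda A) * r)]

/-- An orbit can only leave a disk through its unstable side: there `s₁` is comparable to the
radius. -/
lemma IsSlowProfile.le_of_exit {L : ℝ} (hL : 0 ≤ L) (hr : 0 < r) (hψ : IsSlowProfile r ψ)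
    {s : ℝ × ℝ} (hs : nsq s < R ^ 2) (hT : R ^ 2 ≤ nsq (timeOne L ψ s)) :
    R ^ 2 ≤ (Real.exp (2 * L) + 1) * s.1 ^ 2 := by
  obtain ⟨θ, ⟨h0, h1⟩, hθ⟩ := hψ.exists_timeOne_eq hr hL s
  set E := Real.exp θ with hE
  have hE1 : 1 ≤ E := Real.one_le_exp h0
  have hE2 : E ^ 2 ≤ Real.exp (2 * L) := by
    rw [hE, ← Real.exp_nat_mul]; exact Real.exp_le_exp.2 (by push_cast; linarith)
  have hinv : Real.exp (-θ) = E⁻¹ := Real.exp_neg θ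
  rw [hθ, hinv] at hT
  simp only [nsq, mul_pow, inv_pow] at hT hs
  have hF : 1 ≤ E ^ 2 := by nlinarith
  set F := E ^ 2
  -- growth of `s₁² + s₂²` forces `s₂² ≤ F s₁²`
  have h2 : s.1 ^ 2 + s.2 ^ 2 < s.1 ^ 2 * F + s.2 ^ 2 * F⁻¹ := hs.trans_le hT
  have h3 : (F - 1) * (s.2 ^ 2 * F⁻¹) < (F - 1) * s.1 ^ 2 := by
    have : s.2 ^ 2 = F * (s.2 ^ 2 * F⁻¹) := by field_simp
    nlinarith
  have h4 : s.2 ^ 2 * F⁻¹ < s.1 ^ 2 := lt_of_mul_lt_mul_left h3 (by linarith)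
  nlinarith [mul_le_mul_of_nonneg_right hE2 (sq_nonneg s.1)]

/-- The slowed-down map expands infinitesimally by at most the factor `e^Λ`, up to a small error and
up to the coboundary of the potential. -/
lemma expandsAtMost_slowedMap (hA : 2 < A 0 0 + A 1 1) (hinj : ∀ s t : ℝ × ℝ, nsq s ≤ R ^ 2 →
      nsq t ≤ R ^ 2 → eigenPoint A s = eigenPoint A t → s = t) (hr : 0 < r) (hδ : 0 < δ)
    (hψ : IsSlowProfile r ψ) (hR : 2 * Real.exp (bigLambda A) * r < R)
    (hexit : (Real.exp (2 * bigLambda A) + 1) * Real.exp (400 / δ) * r ^ 2 ≤ R ^ 2)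
    {ε : ℝ} (hε : 0 < ε) (p : Torus) :
    ExpandsAtMost A (slowedMap A r ψ) p (Real.exp (2 * bigLambda A + ε + (2 * bigLambda A + 1) * δ +
      torusPotential A R r δ (slowedMap A r ψ p) - torusPotential A R r δ p)) := by
  have hL := bigLambda_pos hA
  set L := bigLambda A with hLdef
  have hE := Real.exp_pos L
  by_cases hp : ∃ s : ℝ × ℝ, nsq s < R ^ 2 ∧ eigenPoint A s = p
  · obtain ⟨s, hs, rfl⟩ := hp
    obtain ⟨ρ, hρ, H⟩ := hψ.exists_nsq_timeOne_sub_le hr hL.le s hε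
    have hopen : ∃ σ > 0, ∀ w : ℝ × ℝ, nsq w < σ → nsq (s + w) < R ^ 2 := by
      have hc : ContinuousAt (fun w : ℝ × ℝ => nsq (s + w)) 0 := by unfold nsq; fun_prop
      have h1 := hc.eventually (gt_mem_nhds (by simpa using hs))
      obtain ⟨σ, hσ, h2⟩ := Metric.eventually_nhds_iff.1 h1
      refine ⟨σ ^ 2, by positivity, fun w hw => h2 ?_⟩
      rw [dist_zero_right]
      exact lt_of_pow_lt_pow_left₀ 2 hσ.le ((norm_sq_le_nsq w).trans_lt hw)
    obtain ⟨σ, hσ, hopen⟩ := hopen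
    have hG : ∀ t, nsq t < R ^ 2 → slowedMap A r ψ (eigenPoint A t) = eigenPoint A (timeOne L ψ t) :=
      fun t ht => slowedMap_eigenPoint hA hinj hr hψ hR.le ht.le
    refine ExpandsAtMost.mono (c := Real.exp (2 * L + ε + 400 * (sat ((timeOne L ψ s).1 ^ 2 / r ^ 2)
      - sat (s.1 ^ 2 / r ^ 2)))) ⟨min ρ σ, by positivity, fun w hw => ?_⟩ ?_
    · refine ⟨_, ?_, H w (hw.trans_le (min_le_left _ _))⟩
      rw [← eigenPoint_add, hG _ (hopen w (hw.trans_le (min_le_right _ _))), hG s hs,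
        ← eigenPoint_add, add_sub_cancel]
    · apply Real.exp_le_exp.2
      have hr2 : 0 < r ^ 2 := by positivity
      have hx : 0 ≤ s.1 ^ 2 / r ^ 2 := by positivity
      have hy : 0 ≤ (timeOne L ψ s).1 ^ 2 / r ^ 2 := by positivity
      rw [hG s hs, torusPotential_eigenPoint hinj hs]
      rcases lt_or_ge (nsq (timeOne L ψ s)) (R ^ 2) with hT | hT
      · rw [torusPotential_eigenPoint hinj hT]
        obtain ⟨θ, ⟨h0, h1⟩, hθ⟩ := hψ.exists_timeOne_eq hr hL.le s
        have hy' : (timeOne L ψ s).1 ^ 2 / r ^ 2 = Real.exp (2 * θ) * (s.1 ^ 2 / r ^ 2) := by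
          rw [hθ, show 2 * θ = θ + θ by ring, Real.exp_add]; ring
        have h2 := sat_sub_le_potential_sub (y := (timeOne L ψ s).1 ^ 2 / r ^ 2) hL.le hδ.le hx
          (by
            rw [hy']
            exact le_mul_of_one_le_left hx (Real.one_le_exp (by linarith)))
          (by rw [hy']; gcongr)
        linarith
      · have h1 := hψ.le_of_exit hL.le hr hs hT
        have h2 : Real.exp (400 / δ) ≤ s.1 ^ 2 / r ^ 2 := by
          rw [le_div_iff₀ hr2]
          have hW : 0 < Real.exp (2 * L) + 1 := by positivity
          refine le_of_mul_le_mul_left ?_ hW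
          linarith
        have h3 := potential_eq_zero hδ h2
        have h4 := sat_sub_le_of_potential_eq_zero hδ.le ((Real.exp_pos _).trans_le h2) hy h3
        have h5 := torusPotential_nonneg (A := A) R r δ (eigenPoint A (timeOne L ψ s))
        have h6 : 0 ≤ L * δ := by positivity
        rw [h3]
        linarith
  · have hp0 : torusPotential A R r δ p = 0 := dif_neg hp
    have hcl : IsClosed (eigenPoint A '' {s | nsq s ≤ (2 * Real.exp L * r) ^ 2}) := by
      refine (IsCompact.image ?_ continuous_eigenPoint).isClosed
      refine Metric.isCompact_of_isClosed_isBounded ?_ ?_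
      · exact isClosed_le (by unfold nsq; fun_prop) continuous_const
      · refine (Metric.isBounded_closedBall (x := (0 : ℝ × ℝ)) (r := 2 * Real.exp L * r)).subset
          fun s hs => ?_
        rw [mem_closedBall_zero_iff]
        exact (pow_le_pow_iff_left₀ (norm_nonneg _) (by positivity) two_ne_zero).1
          ((norm_sq_le_nsq s).trans hs)
    have hpn : p ∉ eigenPoint A '' {s | nsq s ≤ (2 * Real.exp L * r) ^ 2} := by
      rintro ⟨s, hs, rfl⟩
      exact hp ⟨s, lt_of_le_of_lt hs (pow_lt_pow_left₀ hR (by positivity) two_ne_zero), rfl⟩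
    have hG : ∀ q, q ∉ eigenPoint A '' {s | nsq s ≤ (2 * Real.exp L * r) ^ 2} →
        slowedMap A r ψ q = toralAut A q := fun q hq =>
      dif_neg fun ⟨s, hs, h⟩ => hq ⟨s, hs, h⟩
    have hnear : ∃ σ > 0, ∀ w : ℝ × ℝ, nsq w < σ →
        p + eigenPoint A w ∉ eigenPoint A '' {s | nsq s ≤ (2 * Real.exp L * r) ^ 2} := by
      have hc : Continuous fun w : ℝ × ℝ => p + eigenPoint A w :=
        continuous_const.add continuous_eigenPoint
      have he0 : eigenPoint A 0 = 0 := by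
        have := eigenPoint_add (A := A) 0 0
        simpa using this
      have h1 : ∀ᶠ w in 𝓝 (0 : ℝ × ℝ), p + eigenPoint A w ∈
          (eigenPoint A '' {s | nsq s ≤ (2 * Real.exp L * r) ^ 2})ᶜ :=
        hc.continuousAt.eventually_mem (hcl.isOpen_compl.mem_nhds (by simpa [he0] using hpn))
      obtain ⟨σ, hσ, h2⟩ := Metric.eventually_nhds_iff.1 h1
      refine ⟨σ ^ 2, by positivity, fun w hw => h2 ?_⟩
      rw [dist_zero_right]
      exact lt_of_pow_lt_pow_left₀ 2 hσ.le ((norm_sq_le_nsq w).trans_lt hw)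
    obtain ⟨σ, hσ, hnear⟩ := hnear
    refine ExpandsAtMost.mono (c := Real.exp (2 * L)) ⟨σ, hσ, fun w hw =>
      ⟨(w.1 * Real.exp L, w.2 * Real.exp (-L)), ?_, ?_⟩⟩ ?_
    · rw [hG _ (hnear w hw), hG p hpn, toralAut_add, toralAut_eigenPoint hA]
    · have e1 : Real.exp L ^ 2 = Real.exp (2 * L) := by rw [← Real.exp_nat_mul]; norm_num
      have e2 : Real.exp (-L) ^ 2 ≤ Real.exp (2 * L) := by
        rw [← e1]; gcongr; linarith
      simp only [nsq, mul_pow, e1]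
      nlinarith [sq_nonneg w.2]
    · apply Real.exp_le_exp.2
      have h5 := torusPotential_nonneg (A := A) R r δ (slowedMap A r ψ p)
      have h6 : 0 ≤ (2 * L + 1) * δ := by positivity
      linarith

end Embedded

lemma slowedMap_congr {r : ℝ} {ψ φ : ℝ → ℝ} (h : ∀ u, 0 ≤ u → ψ u = φ u) :
    slowedMap A r ψ = slowedMap A r φ := by
  have h1 : slowField (bigLambda A) ψ = slowField (bigLambda A) φ := by
    ext s <;> simp only [slowField, h _ (show 0 ≤ s.1 ^ 2 + s.2 ^ 2 by positivity)]
  have h2 : timeOne (bigLambda A) ψ = timeOne (bigLambda A) φ := by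
    ext s : 1; unfold timeOne; rw [h1]
  ext p : 1
  unfold slowedMap
  rw [h2]

end SlowDown

end

theorem lemma3p5 (A : Matrix.SpecialLinearGroup (Fin 2) ℤ) (hA : 2 < A 0 0 + A 1 1)
    (α ε : ℝ) (hα : α ∈ Set.Ioo (0 : ℝ) (1 / 3)) (hε : ε ∈ Set.Ioo (0 : ℝ) 1)
    (hαε : (1 + α) / (1 - ε) ^ (2 * (1 + α)) < 4 / 3) (χ : ℝ) (hχ : 0 < χ) :
    ∃ rχ ∈ Set.Ioo (0 : ℝ) 1, ∀ r₀ ∈ Set.Ioo (0 : ℝ) rχ, ∀ ψ : ℝ → ℝ → ℝ,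
      SlowDown.IsSlowDownFamily α ε r₀ ψ → ∀ η ∈ Set.Ioc (0 : ℝ) (2 * r₀ ^ 2),
        (∀ (p : SlowDown.Torus) (v : SlowDown.Plane), v ≠ 0 →
          SlowDown.lyapunovExponent (SlowDown.slowedMap A r₀ (ψ η)) p v
            < ((SlowDown.bigLambda A + χ : ℝ) : EReal)) ∧
        (∀ l : ℝ, SlowDown.IsLambdaMME (SlowDown.slowedMap A r₀ (ψ η)) l →
          l < SlowDown.bigLambda A + χ) := by
  have hL := SlowDown.bigLambda_pos hA
  obtain ⟨R, hR, hinj⟩ := SlowDown.exists_eigenPoint_injOn hA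
  set L := SlowDown.bigLambda A with hLdef
  set δ : ℝ := χ / (2 * (2 * L + 1)) with hδdef
  have hδ : 0 < δ := by positivity
  set W : ℝ := (Real.exp (2 * L) + 1) * Real.exp (400 / δ) with hW
  have hE1 : Real.exp L ≤ Real.exp (2 * L) := Real.exp_le_exp.2 (by linarith)
  have hE2 : 1 ≤ Real.exp (400 / δ) := Real.one_le_exp (by positivity)
  have hW1 : Real.exp L ≤ W := by nlinarith [Real.exp_pos (2 * L)]
  have hW2 : 1 ≤ W := by nlinarith [Real.exp_pos (2 * L)]
  refine ⟨min (1 / 2) (R / (2 * W)), ⟨by positivity, (min_le_left _ _).trans_lt (by norm_num)⟩, ?_⟩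
  intro r₀ hr₀ ψ hψ η hη
  obtain ⟨hr, hr'⟩ := hr₀
  have hr1 : r₀ < 1 := by linarith [hr'.trans_le (min_le_left (1 / 2 : ℝ) (R / (2 * W)))]
  have hrW : r₀ * (2 * W) < R := by
    have := hr'.trans_le (min_le_right (1 / 2 : ℝ) (R / (2 * W)))
    rwa [lt_div_iff₀ (by positivity)] at this
  have hprof := hψ.isSlowProfile hα ⟨hr, hr1⟩ hαε hη
  have hcongr : SlowDown.slowedMap A r₀ (ψ η) =
      SlowDown.slowedMap A r₀ (fun u => ψ η (max u 0)) :=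
    SlowDown.slowedMap_congr fun u hu => by rw [max_eq_left hu]
  have hstep := SlowDown.expandsAtMost_slowedMap hA hinj hr hδ hprof (by nlinarith)
    (by
      have h1 : W * r₀ ^ 2 ≤ (r₀ * (2 * W)) ^ 2 := by nlinarith [sq_nonneg r₀]
      exact h1.trans (pow_le_pow_left₀ (by positivity) hrW.le 2))
    (half_pos hχ)
  have hconst : 2 * L + χ / 2 + (2 * L + 1) * δ = 2 * L + χ := by
    rw [hδdef]; field_simp; ring
  rw [← hcongr, ← hLdef, hconst] at hstep
  -- the potential is bounded, hence does not contribute to the exponential growth rate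
  have hpot : ∀ q, SlowDown.torusPotential A R r₀ δ q ≤ 400 := fun q => by
    have h : ∀ x : ℝ, 0 ≤ x → SlowDown.potential δ x ≤ 400 := fun x hx => by
      refine max_le (by norm_num) ?_
      have h1 := SlowDown.sat_le_one hx
      have h2 := mul_nonneg hδ.le (Real.log_nonneg (show 1 ≤ 1 + x by linarith))
      linarith
    unfold SlowDown.torusPotential
    split_ifs
    · exact h _ (by positivity)
    · norm_num
  have hlyap : ∀ (p : SlowDown.Torus) (v : SlowDown.Plane),
      SlowDown.lyapunovExponent (SlowDown.slowedMap A r₀ (ψ η)) p v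
        < ((L + χ : ℝ) : EReal) := fun p v => by
    refine (SlowDown.lyapunovExponent_le hA (B := 2 * L + χ) (C := 400) (by positivity)
      (fun n => ?_) v).trans_lt (EReal.coe_lt_coe_iff.2 (by linarith))
    refine (SlowDown.ExpandsAtMost.iterate hstep n p).mono (Real.exp_le_exp.2 ?_)
    have h1 := hpot ((SlowDown.slowedMap A r₀ (ψ η))^[n] p)
    have h2 := SlowDown.torusPotential_nonneg (A := A) R r₀ δ p
    linarith
  refine ⟨fun p v _ => hlyap p v, ?_⟩
  rintro l ⟨ν, hν, -, hl⟩
  have := hν.prob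
  obtain ⟨p, v, -, hv⟩ := hl.exists
  have hlim := ((continuous_coe_real_ereal.tendsto l).comp hv).limsup_eq
  have h := hlyap p v
  rw [SlowDown.lyapunovExponent] at h
  exact EReal.coe_lt_coe_iff.1 (hlim ▸ h)
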